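/- Let $0\le q\in L_1^{\rm loc}(\mathbb R)$ satisfy $\int_{-\infty}^x q(t)\,dt>0$ and $\int_x^\infty q(t)\,dt>0$ for all $x\in\mathbb R$ (infinite values allowed), and let $\mu,\theta:\mathbb R\to(0,\infty)$ be continuous. For each $x\in\mathbb R$ let $d(x)>0$ be the unique solution $d\ge 0$ of $$\int_0^{\sqrt2\,d}\int_{x-t}^{x+t}q(\xi)\,d\xi\,dt=2 .$$ For a positive continuous weight $w$ and $p\in[1,\infty)$ let $L_{p,w}$ be the space of $f\in L_p^{\rm loc}(\mathbb R)$ with $\|f\|_{p,w}=\left(\int_{-\infty}^\infty|w(x)f(x)|^p\,dx\right)^{1/p}<\infty$. A solution of $$-y''(x)+q(x)y(x)=f(x),\qquad x\in\mathbb R, \tag{1}$$ is a function $y$ that is (locally) absolutely continuous together with its derivative $y'$ and satisfies (1) almost everywhere. The pair $\{L_{p,\mu},L_{p,\theta}\}$ is called admissible for (1) if for every $f\in L_{p,\theta}$ there is a unique solution $y\in L_{p,\mu}$ of (1), and there is a constant $c(p)\in(0,\infty)$ such that $\|y\|_{p,\mu}\le c(p)\|f\|_{p,\theta}$ for every $f\in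 L_{p,\theta}$ and the corresponding solution $y\in L_{p,\mu}$. Assume that: (a) $\int_{-\infty}^0\mu(t)\,dt=\int_0^\infty\mu(t)\,dt=\infty$; (b) $q\in H$, that is, $\nu(x)\to0$ as $|x|\to\infty$, where $\nu(x)=d(x)\int_0^{\sqrt2\,d(x)}\bigl(q(x+t)-q(x-t)\bigr)dt$; (c) the pair $\{\mu,\theta\}$ agrees with $q$, that is, for every $\varepsilon>0$ there is a constant $c(\varepsilon)\in[1,\infty)$ such that for all $t,x\in\mathbb R$ each of the two quantities $$\sqrt{\frac{d(t)}{d(x)}}\,\frac{\mu(t)}{\mu(x)},\qquad \sqrt{\frac{d(t)}{d(x)}}\,\frac{\theta(x)}{\theta(t)}$$ lies between $c(\varepsilon)^{-1}\exp\left(-\varepsilon\left|\int_x^t\frac{d\xi}{d(\xi)}\right|\right)$ and $c(\varepsilon)\exp\left(\varepsilon\left|\int_x^t\frac{d\xi}{d(\xi)}\right|\right)$. Then for each $p\in[1,\infty)$ the pair $\{L_{p,\mu},L_{p,\theta}\}$ is admissible for (1) if and only if $$m(q,\mu,\theta)=\sup_{x\in\mathbb R}\left(\frac{\mu(x)}{\theta(x)}\,d(x)^2\right)<\infty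 .$$ -/

import Mathlib

open MeasureTheory Filter Set
open scoped ENNReal Topology

namespace SturmLiouville

/-- `f ∈ L_p^loc(ℝ)`. -/
def MemLpLoc (f : ℝ → ℝ) (p : ℝ≥0∞) : Prop :=
  AEStronglyMeasurable f volume ∧ ∀ K : Set ℝ, IsCompact K → MemLp f p (volume.restrict K)

/-- The weighted norm `(∫ |w f|^p)^(1/p)`, with value `∞` allowed. -/
noncomputable def weightedNorm (w : ℝ → ℝ) (p : ℝ≥0∞) (f : ℝ → ℝ) : ℝ≥0∞ :=
  eLpNorm (fun x => w x * f x) p volume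

/-- `f ∈ L_p(ℝ, w)`. -/
def MemWeightedLp (w : ℝ → ℝ) (p : ℝ≥0∞) (f : ℝ → ℝ) : Prop :=
  MemLpLoc f p ∧ weightedNorm w p f < ∞

/-- Absolute continuity on every compact interval. -/
def LocallyAC (g : ℝ → ℝ) : Prop :=
  ∀ a b : ℝ, AbsolutelyContinuousOnInterval g a b

/-- `y` is a solution of `-y'' + q y = f` on `ℝ`: `y` is differentiable, `y` and `y'` are locally
absolutely continuous, and the equation holds almost everywhere. -/
def IsSolution (q f y : ℝ → ℝ) : Prop :=
  Differentiable ℝ y ∧ LocallyAC y ∧ LocallyAC (deriv y) ∧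
    ∀ᵐ x : ℝ, -deriv (deriv y) x + q x * y x = f x

/-- The pair `{L_{p,μ}, L_{p,θ}}` is admissible for `-y'' + q y = f`. -/
def IsAdmissible (q μ θ : ℝ → ℝ) (p : ℝ≥0∞) : Prop :=
  (∀ f : ℝ → ℝ, MemWeightedLp θ p f → ∃! y : ℝ → ℝ, IsSolution q f y ∧ MemWeightedLp μ p y) ∧
  ∃ c : ℝ, 0 < c ∧ ∀ f y : ℝ → ℝ, MemWeightedLp θ p f → IsSolution q f y → MemWeightedLp μ p y →
    weightedNorm μ p y ≤ ENNReal.ofReal c * weightedNorm θ p f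

/-- `∫_{-∞}^x q > 0` and `∫_x^∞ q > 0` for all `x` (for `q ≥ 0`; the integrals may be infinite). -/
def PositiveTails (q : ℝ → ℝ) : Prop :=
  ∀ x : ℝ, 0 < ∫⁻ t in Iic x, ENNReal.ofReal (q t) ∧ 0 < ∫⁻ t in Ici x, ENNReal.ofReal (q t)

/-- `∫_{-∞}^0 w = ∫_0^∞ w = ∞` (for `w ≥ 0`). -/
def DivergentTails (w : ℝ → ℝ) : Prop :=
  ∫⁻ t in Iic (0 : ℝ), ENNReal.ofReal (w t) = ∞ ∧ ∫⁻ t in Ici (0 : ℝ), ENNReal.ofReal (w t) = ∞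

/-- `F_x(η) = ∫_0^{√2 η} ∫_{x-t}^{x+t} q(ξ) dξ dt`. -/
noncomputable def averagingIntegral (q : ℝ → ℝ) (x η : ℝ) : ℝ :=
  ∫ t in (0 : ℝ)..(√2 * η), ∫ ξ in (x - t)..(x + t), q ξ

/-- `d(x)`, the solution `η ≥ 0` of `F_x(η) = 2`; it exists and is unique by
`existsUnique_averagingRadius` below, so the infimum is that of a one-point set. -/
noncomputable def averagingRadius (q : ℝ → ℝ) (x : ℝ) : ℝ :=
  sInf {η : ℝ | 0 ≤ η ∧ averagingIntegral q x η = 2}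

/-- `ν(x) = d(x) ∫_0^{√2 d(x)} (q(x+t) - q(x-t)) dt`. -/
noncomputable def nu (q : ℝ → ℝ) (x : ℝ) : ℝ :=
  averagingRadius q x * ∫ t in (0 : ℝ)..(√2 * averagingRadius q x), (q (x + t) - q (x - t))

/-- `q ∈ H`: `ν(x) → 0` as `|x| → ∞`. -/
def ClassH (q : ℝ → ℝ) : Prop :=
  Tendsto (nu q) (cocompact ℝ) (𝓝 0)

/-- `|∫_x^t dξ / d(ξ)|`. -/
noncomputable def averagingDist (q : ℝ → ℝ) (x t : ℝ) : ℝ :=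
  |∫ ξ in x..t, 1 / averagingRadius q ξ|

/-- The pair of weights `{μ, θ}` agrees with `q`. -/
def Agrees (q μ θ : ℝ → ℝ) : Prop :=
  ∀ ε : ℝ, 0 < ε → ∃ c : ℝ, 1 ≤ c ∧ ∀ t x : ℝ,
    √(averagingRadius q t / averagingRadius q x) * (μ t / μ x) ∈
      Icc (c⁻¹ * Real.exp (-ε * averagingDist q x t)) (c * Real.exp (ε * averagingDist q x t)) ∧
    √(averagingRadius q t / averagingRadius q x) * (θ x / θ t) ∈
      Icc (c⁻¹ * Real.exp (-ε * averagingDist q x t)) (c * Real.exp (ε * averagingDist q x t))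

/-- `m(q, μ, θ) = sup_x μ(x) d(x)² / θ(x)`, as an element of `[0, ∞]`. -/
noncomputable def weightSup (q μ θ : ℝ → ℝ) : ℝ≥0∞ :=
  ⨆ x : ℝ, ENNReal.ofReal (μ x / θ x * averagingRadius q x ^ 2)

/-- `F_x(η) = 2` has exactly one solution `η ≥ 0`. -/
theorem existsUnique_averagingRadius (q : ℝ → ℝ) (hq : LocallyIntegrable q volume)
    (hq0 : ∀ᵐ x : ℝ, 0 ≤ q x) (hpos : PositiveTails q) (x : ℝ) :
    ∃! η : ℝ, 0 ≤ η ∧ averagingIntegral q x η = 2 := by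
  have hii : ∀ a b : ℝ, IntervalIntegrable q volume a b := fun a b =>
    (hq.integrableOn_isCompact isCompact_uIcc).intervalIntegrable
  set g : ℝ → ℝ := fun t => ∫ ξ in (x - t)..(x + t), q ξ with hg
  have hgc : Continuous g := by
    have h0 : Continuous fun b : ℝ => ∫ ξ in (0 : ℝ)..b, q ξ :=
      intervalIntegral.continuous_primitive hii 0
    have : g = fun t => (∫ ξ in (0 : ℝ)..(x + t), q ξ) - ∫ ξ in (0 : ℝ)..(x - t), q ξ := by
      funext t
      exact (intervalIntegral.integral_interval_sub_left (hii _ _) (hii _ _)).symm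
    rw [this]
    exact (h0.comp (by fun_prop)).sub (h0.comp (by fun_prop))
  have hmono : ∀ s t : ℝ, 0 ≤ s → s ≤ t → g s ≤ g t := by
    intro s t hs hst
    exact intervalIntegral.integral_mono_interval (by linarith) (by linarith) (by linarith)
      (ae_restrict_of_ae hq0) (hii _ _)
  have hg0 : g 0 = 0 := by simp [hg]
  have hnn : ∀ t : ℝ, 0 ≤ t → 0 ≤ g t := fun t ht => hg0 ▸ hmono 0 t le_rfl ht
  -- some window has positive mass
  obtain ⟨T, hT0, hT⟩ : ∃ T : ℝ, 0 ≤ T ∧ 0 < g T := by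
    by_contra! hcon
    have hz : ∀ n : ℕ, ∫⁻ ξ in Ioc (x - n) (x + n), ENNReal.ofReal (q ξ) = 0 := by
      intro n
      have h1 : g n = 0 := le_antisymm (hcon n n.cast_nonneg) (hnn n n.cast_nonneg)
      have hle : x - n ≤ x + (n : ℝ) := by have := n.cast_nonneg (α := ℝ); linarith
      have h2 : ∫ ξ in Ioc (x - n) (x + n), q ξ = 0 := by
        rw [← intervalIntegral.integral_of_le hle]; exact h1
      rw [← ofReal_integral_eq_lintegral_ofReal
        ((intervalIntegrable_iff_integrableOn_Ioc_of_le hle).1 (hii _ _))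
        (ae_restrict_of_ae hq0), h2, ENNReal.ofReal_zero]
    have hU : (⋃ n : ℕ, Ioc (x - n) (x + n)) = univ := by
      refine eq_univ_of_forall fun y => mem_iUnion.2 ?_
      obtain ⟨n, hn⟩ := exists_nat_gt |y - x|
      have := abs_lt.1 hn
      exact ⟨n, by constructor <;> linarith⟩
    have hall : ∫⁻ ξ in univ, ENNReal.ofReal (q ξ) = 0 := by
      rw [← hU]
      refine le_antisymm ((lintegral_iUnion_le _ _).trans ?_) bot_le
      simp [hz]
    have := (hpos x).1.trans_le (lintegral_mono_set (subset_univ (Iic x)))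
    exact this.ne' hall
  have hgi : ∀ a b : ℝ, IntervalIntegrable g volume a b := fun a b => hgc.intervalIntegrable a b
  have h2 : (0 : ℝ) < √2 := by positivity
  have hF : ∀ η, averagingIntegral q x η = ∫ t in (0 : ℝ)..(√2 * η), g t := fun η => rfl
  have hFc : Continuous (averagingIntegral q x) := by
    have := (intervalIntegral.continuous_primitive hgi 0).comp (continuous_const_mul √2)
    exact this
  have hF0 : averagingIntegral q x 0 = 0 := by simp [hF]
  -- the integral over a longer interval exceeds by the length times the left value
  have hstep : ∀ s t : ℝ, 0 ≤ s → s ≤ t →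
      (t - s) * g s ≤ (∫ r in (0 : ℝ)..t, g r) - ∫ r in (0 : ℝ)..s, g r := by
    intro s t hs hst
    rw [intervalIntegral.integral_interval_sub_left (hgi _ _) (hgi _ _)]
    have := intervalIntegral.integral_mono_on hst (intervalIntegrable_const (c := g s)) (hgi s t)
      (fun r hr => hmono s r hs hr.1)
    simpa using this
  obtain ⟨R, hR0, hR⟩ : ∃ R : ℝ, 0 ≤ R ∧ 2 ≤ averagingIntegral q x R := by
    refine ⟨(T + 2 / g T) / √2, by positivity, ?_⟩
    rw [hF, mul_div_cancel₀ _ h2.ne']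
    have h1 := hstep T (T + 2 / g T) hT0 (by have : 0 < 2 / g T := by positivity
                                             linarith)
    have h3 : 0 ≤ ∫ r in (0 : ℝ)..T, g r :=
      intervalIntegral.integral_nonneg hT0 fun r hr => hnn r hr.1
    have h4 : (T + 2 / g T - T) * g T = 2 := by field_simp; ring
    linarith
  obtain ⟨η, hη, hη2⟩ := intermediate_value_Icc hR0 hFc.continuousOn
    (show (2 : ℝ) ∈ Icc (averagingIntegral q x 0) (averagingIntegral q x R) from
      ⟨by rw [hF0]; norm_num, hR⟩)
  have huniq : ∀ a b : ℝ, 0 ≤ a → a < b → averagingIntegral q x a = 2 →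
      averagingIntegral q x b = 2 → False := by
    intro a b ha hab h1 h3
    have hs : 0 ≤ √2 * a := by positivity
    have hlt : √2 * a < √2 * b := mul_lt_mul_of_pos_left hab h2
    have h4 := hstep _ _ hs hlt.le
    rw [← hF, ← hF, h1, h3] at h4
    have h5 : g (√2 * a) ≤ 0 := by
      by_contra! h
      have := mul_pos (sub_pos.2 hlt) h
      linarith
    have h6 : ∫ t in (0 : ℝ)..(√2 * a), g t ≤ ∫ t in (0 : ℝ)..(√2 * a), (0 : ℝ) :=
      intervalIntegral.integral_mono_on hs (hgi _ _) intervalIntegrable_const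
        fun r hr => (hmono r _ hr.1 hr.2).trans h5
    rw [← hF, h1] at h6
    norm_num at h6
  refine ⟨η, ⟨hη.1, hη2⟩, fun η' h' => ?_⟩
  rcases lt_trichotomy η' η with h | h | h
  · exact (huniq _ _ h'.1 h h'.2 hη2).elim
  · exact h
  · exact (huniq _ _ hη.1 h hη2 h'.2).elim

/-- `d(x)` is positive and solves its defining equation. -/
theorem averagingRadius_spec (q : ℝ → ℝ) (hq : LocallyIntegrable q volume)
    (hq0 : ∀ᵐ x : ℝ, 0 ≤ q x) (hpos : PositiveTails q) (x : ℝ) :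
    0 < averagingRadius q x ∧ averagingIntegral q x (averagingRadius q x) = 2 := by
  obtain ⟨η, h, hu⟩ := existsUnique_averagingRadius q hq hq0 hpos x
  have hs : {η : ℝ | 0 ≤ η ∧ averagingIntegral q x η = 2} = {η} := by
    ext y
    exact ⟨fun hy => hu y hy, fun hy => hy ▸ h⟩
  have hd : averagingRadius q x = η := by rw [averagingRadius, hs, csInf_singleton]
  rw [hd]
  refine ⟨h.1.lt_of_ne fun h0 => ?_, h.2⟩
  have := h.2
  rw [← h0] at this
  simp [averagingIntegral] at this

end SturmLiouville

/-!
The homogeneous equation has a positive nonincreasing solution `u` and a positive nondecreasing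
solution `v` of Wronskian `1`, and the Green function `G(x, t) = u (max x t) * v (min x t)`
satisfies two bounds governed by the averaging radius `d`:

* `d x / 24 ≤ G(x, x) ≤ 3 * d x`, because `q` has mass of order `1 / d x` in a window of
  radius `d x` about `x`;
* `G(x, t) ≤ 3 * √(d x * d t) * exp (-ρ(x, t) / 6)` with `ρ(x, t) = |∫_x^t dξ / d ξ|`, because
  `v / u` has logarithmic derivative `1 / (u * v)`.

Since the weights vary subexponentially in `ρ`, the kernel `μ x * G(x, t) / θ t` is at most a
constant multiple of `m(q, μ, θ) * exp (-ρ(x, t) / 12)` divided by `d x` or by `d t`, and Schur's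
test with the substitution `s = ∫ dξ / d ξ` bounds the Green operator. Subexponential growth also
makes `μ * v` at `∞` and `μ * u` at `-∞` tend to infinity, so that the homogeneous equation has no
nonzero solution in `L_{p,μ}`. Conversely, by this uniqueness the solution for the indicator of an
interval of length comparable to `d x` about `x` is given by the Green operator, hence is at least
a multiple of `d x ^ 2` on that interval; comparing norms bounds `μ x / θ x * d x ^ 2`.
-/

namespace SturmLiouville

/-! ### Locally absolutely continuous functions -/

theorem intervalIntegrable_of_locallyIntegrable {g : ℝ → ℝ} (hg : LocallyIntegrable g volume)
    (a b : ℝ) : IntervalIntegrable g volume a b :=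
  (hg.integrableOn_isCompact isCompact_uIcc).intervalIntegrable

namespace LocallyAC

variable {g h g' : ℝ → ℝ}

theorem add (hg : LocallyAC g) (hh : LocallyAC h) : LocallyAC (g + h) :=
  fun a b => (hg a b).add (hh a b)

theorem sub (hg : LocallyAC g) (hh : LocallyAC h) : LocallyAC (g - h) :=
  fun a b => (hg a b).sub (hh a b)

theorem mul (hg : LocallyAC g) (hh : LocallyAC h) : LocallyAC (g * h) :=
  fun a b => (hg a b).mul (hh a b)

theorem const_smul (c : ℝ) (hg : LocallyAC g) : LocallyAC (c • g) :=
  fun a b => (hg a b).const_smul c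

theorem continuous (hg : LocallyAC g) : Continuous g := by
  refine continuous_iff_continuousAt.2 fun x => ?_
  refine (hg (x - 1) (x + 1)).continuousOn.continuousAt ?_
  rw [uIcc_of_le (by linarith)]
  exact Icc_mem_nhds (by linarith) (by linarith)

theorem ae_differentiableAt (hg : LocallyAC g) : ∀ᵐ x : ℝ, DifferentiableAt ℝ g x := by
  have on_intervals : ∀ᵐ x : ℝ, ∀ n : ℕ, x ∈ uIcc (-(n : ℝ)) n → DifferentiableAt ℝ g x :=
    ae_all_iff.2 fun n => (hg _ _).ae_differentiableAt
  filter_upwards [on_intervals] with x hx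
  obtain ⟨n, hn⟩ := exists_nat_ge |x|
  exact hx n (Icc_subset_uIcc (abs_le.1 hn))

theorem integral_eq_sub (hg : LocallyAC g) (hd : ∀ᵐ x, HasDerivAt g (g' x) x) (a b : ℝ) :
    ∫ x in a..b, g' x = g b - g a := by
  rw [← (hg a b).integral_deriv_eq_sub]
  exact intervalIntegral.integral_congr_ae (hd.mono fun x hx _ => hx.deriv.symm)

theorem monotone (hg : LocallyAC g) (hd : ∀ᵐ x, HasDerivAt g (g' x) x)
    (h0 : ∀ᵐ x, 0 ≤ g' x) : Monotone g := fun a b hab => by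
  have : 0 ≤ ∫ x in a..b, g' x := intervalIntegral.integral_nonneg_of_ae hab h0
  linarith [hg.integral_eq_sub hd a b]

theorem of_eq_add_integral (hg' : ∀ a b, IntervalIntegrable g' volume a b)
    (hg : ∀ x, g x = g 0 + ∫ t in (0 : ℝ)..x, g' t) : LocallyAC g := by
  intro a b
  have primitive_ac : AbsolutelyContinuousOnInterval (fun x => ∫ t in (0 : ℝ)..x, g' t)
      (min 0 (min a b)) (max 0 (max a b)) := by
    refine (hg' _ _).absolutelyContinuousOnInterval_intervalIntegral (Icc_subset_uIcc ?_)
    exact ⟨min_le_left _ _, le_max_left _ _⟩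
  rw [funext hg]
  refine (LipschitzWith.const (g 0)).lipschitzOnWith.absolutelyContinuousOnInterval.add
    (primitive_ac.mono ?_)
  exact Subset.trans (Icc_subset_Icc (min_le_right _ _) (le_max_right _ _)) Icc_subset_uIcc

theorem of_hasDerivAt (hd : ∀ x, HasDerivAt g (g' x) x) (hc : Continuous g') : LocallyAC g := by
  refine of_eq_add_integral (fun a b => hc.intervalIntegrable a b) fun x => ?_
  rw [intervalIntegral.integral_eq_sub_of_hasDerivAt (fun y _ => hd y) (hc.intervalIntegrable _ _)]
  ring

theorem hasDerivAt_of_continuous (hg : LocallyAC g) (hd : ∀ᵐ x, HasDerivAt g (g' x) x)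
    (hc : Continuous g') (x : ℝ) : HasDerivAt g (g' x) x := by
  have hg_eq : g = fun x => g 0 + ∫ t in (0 : ℝ)..x, g' t := by
    funext x
    rw [hg.integral_eq_sub hd]
    ring
  have := (hc.integral_hasStrictDerivAt 0 x).hasDerivAt.const_add (g 0)
  rwa [← hg_eq] at this

theorem comp_neg (hg : LocallyAC g) : LocallyAC fun x => g (-x) := by
  refine of_eq_add_integral (g' := fun x => -deriv g (-x)) (fun a b => ?_) fun x => ?_
  · simpa using! ((hg (-a) (-b)).intervalIntegrable_deriv.comp_sub_left 0).neg
  · rw [intervalIntegral.integral_neg, intervalIntegral.integral_comp_neg,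
      (hg _ _).integral_deriv_eq_sub]
    ring

end LocallyAC

/-! ### Solutions of `-y'' + q y = f` -/

namespace IsSolution

variable {q f f₁ y y₁ g : ℝ → ℝ}

theorem hasDerivAt (h : IsSolution q f y) (x : ℝ) : HasDerivAt y (deriv y x) x :=
  (h.1 x).hasDerivAt

theorem locallyAC (h : IsSolution q f y) : LocallyAC y := h.2.1

theorem locallyAC_deriv (h : IsSolution q f y) : LocallyAC (deriv y) := h.2.2.1

theorem continuous (h : IsSolution q f y) : Continuous y := h.locallyAC.continuous

theorem continuous_deriv (h : IsSolution q f y) : Continuous (deriv y) :=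
  h.locallyAC_deriv.continuous

theorem ae_hasDerivAt_deriv (h : IsSolution q f y) :
    ∀ᵐ x, HasDerivAt (deriv y) (q x * y x - f x) x := by
  filter_upwards [h.2.2.2, h.locallyAC_deriv.ae_differentiableAt] with x hx hdx
  convert! hdx.hasDerivAt using 1
  linarith

theorem of_hasDerivAt (hy : ∀ x, HasDerivAt y (g x) x) (hg : LocallyAC g)
    (hg' : ∀ᵐ x, HasDerivAt g (q x * y x - f x) x) : IsSolution q f y := by
  have hderiv : deriv y = g := funext fun x => (hy x).deriv
  refine ⟨fun x => (hy x).differentiableAt, .of_hasDerivAt hy hg.continuous, hderiv ▸ hg, ?_⟩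
  filter_upwards [hg'] with x hx
  rw [hderiv, hx.deriv]
  ring

theorem add (h : IsSolution q f y) (h₁ : IsSolution q f₁ y₁) :
    IsSolution q (f + f₁) (y + y₁) := by
  refine of_hasDerivAt (fun x => (h.hasDerivAt x).add (h₁.hasDerivAt x))
    (h.locallyAC_deriv.add h₁.locallyAC_deriv) ?_
  filter_upwards [h.ae_hasDerivAt_deriv, h₁.ae_hasDerivAt_deriv] with x hx hx₁
  convert! hx.add hx₁ using 1
  simp only [Pi.add_apply]
  ring

theorem const_smul (c : ℝ) (h : IsSolution q f y) : IsSolution q (c • f) (c • y) := by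
  refine of_hasDerivAt (fun x => (h.hasDerivAt x).const_smul c)
    (h.locallyAC_deriv.const_smul c) ?_
  filter_upwards [h.ae_hasDerivAt_deriv] with x hx
  convert! hx.const_smul c using 1
  simp only [Pi.smul_apply, smul_eq_mul]
  ring

theorem sub (h : IsSolution q f y) (h₁ : IsSolution q f₁ y₁) :
    IsSolution q (f - f₁) (y - y₁) := by
  simpa [sub_eq_add_neg] using h.add (h₁.const_smul (-1))

theorem comb (h : IsSolution q 0 y) (h₁ : IsSolution q 0 y₁) (a b : ℝ) :
    IsSolution q 0 (a • y + b • y₁) := by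
  simpa using (h.const_smul a).add (h₁.const_smul b)

theorem deriv_comb (h : IsSolution q 0 y) (h₁ : IsSolution q 0 y₁) (a b x : ℝ) :
    deriv (a • y + b • y₁) x = a * deriv y x + b * deriv y₁ x :=
  (((h.hasDerivAt x).const_smul a).add ((h₁.hasDerivAt x).const_smul b)).deriv

theorem comp_neg (h : IsSolution q f y) :
    IsSolution (fun x => q (-x)) (fun x => f (-x)) fun x => y (-x) := by
  refine of_hasDerivAt (g := (-1 : ℝ) • fun x => deriv y (-x)) (fun x => ?_)
    (h.locallyAC_deriv.comp_neg.const_smul _) ?_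
  · simpa using! (h.hasDerivAt (-x)).comp x (hasDerivAt_neg x)
  · filter_upwards [(Measure.measurePreserving_neg volume).quasiMeasurePreserving.ae
      h.ae_hasDerivAt_deriv] with x hx
    simpa using! (hx.comp x (hasDerivAt_neg x)).const_smul (-1 : ℝ)

theorem wronskian_eq (h : IsSolution q 0 y) (h₁ : IsSolution q 0 y₁) (a b : ℝ) :
    deriv y a * y₁ a - y a * deriv y₁ a = deriv y b * y₁ b - y b * deriv y₁ b := by
  have hW : LocallyAC (deriv y * y₁ - y * deriv y₁) :=
    (h.locallyAC_deriv.mul h₁.locallyAC).sub (h.locallyAC.mul h₁.locallyAC_deriv)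
  have hW' : ∀ᵐ x, HasDerivAt (deriv y * y₁ - y * deriv y₁) 0 x := by
    filter_upwards [h.ae_hasDerivAt_deriv, h₁.ae_hasDerivAt_deriv] with x hx hx₁
    convert! (hx.mul (h₁.hasDerivAt x)).sub ((h.hasDerivAt x).mul hx₁) using 1
    simp only [Pi.zero_apply]
    ring
  have := hW.integral_eq_sub hW' a b
  simp only [intervalIntegral.integral_zero, Pi.sub_apply, Pi.mul_apply] at this
  linarith

theorem integral_eq_deriv_sub (h : IsSolution q 0 y) (a b : ℝ) :
    ∫ x in a..b, q x * y x = deriv y b - deriv y a :=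
  h.locallyAC_deriv.integral_eq_sub (by simpa using h.ae_hasDerivAt_deriv) a b

theorem monotone_deriv (h : IsSolution q 0 y) (hq : ∀ᵐ x, 0 ≤ q x) (hy : ∀ x, 0 ≤ y x) :
    Monotone (deriv y) := by
  refine h.locallyAC_deriv.monotone (g' := fun x => q x * y x)
    (by simpa using h.ae_hasDerivAt_deriv) ?_
  filter_upwards [hq] with x hx
  exact mul_nonneg hx (hy x)

end IsSolution

theorem add_deriv_mul_sub_le {F F' : ℝ → ℝ} (hF : ∀ x, HasDerivAt F (F' x) x)
    (hF' : Monotone F') (a b : ℝ) : F a + F' a * (b - a) ≤ F b := by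
  have hderiv : deriv F = F' := funext fun x => (hF x).deriv
  have hconv : ConvexOn ℝ univ F :=
    (hderiv ▸ hF').convexOn_univ_of_deriv fun x => (hF x).differentiableAt
  rcases lt_trichotomy a b with hab | rfl | hab
  · have := hconv.le_slope_of_hasDerivAt (mem_univ a) (mem_univ b) hab (hF a)
    rw [slope_def_field, le_div_iff₀ (sub_pos.2 hab)] at this
    linarith
  · simp
  · have := hconv.slope_le_of_hasDerivAt (mem_univ b) (mem_univ a) hab (hF a)
    rw [slope_def_field, div_le_iff₀ (sub_pos.2 hab)] at this
    linarith

namespace IsSolution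

variable {q y : ℝ → ℝ}

theorem pos_of_deriv_eq_zero (h : IsSolution q 0 y) (hq : ∀ᵐ x, 0 ≤ q x) {x₀ : ℝ}
    (hy : 0 < y x₀) (hy' : deriv y x₀ = 0) (x : ℝ) : 0 < y x := by
  have hsq_deriv : ∀ x, HasDerivAt (fun x => y x ^ 2) (2 * (y * deriv y) x) x := fun x => by
    convert! (h.hasDerivAt x).pow 2 using 1
    simp only [Pi.mul_apply]
    ring
  have hmono : Monotone (y * deriv y) := by
    refine (h.locallyAC.mul h.locallyAC_deriv).monotone
      (g' := fun x => deriv y x ^ 2 + q x * y x ^ 2) ?_ ?_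
    · filter_upwards [h.ae_hasDerivAt_deriv] with x hx
      convert! (h.hasDerivAt x).mul hx using 1
      simp only [Pi.zero_apply]
      ring
    · filter_upwards [hq] with x hx
      positivity
  have hsq : ∀ z, y x₀ ^ 2 ≤ y z ^ 2 := fun z => by
    simpa [hy'] using add_deriv_mul_sub_le hsq_deriv (hmono.const_mul zero_le_two) x₀ z
  by_contra! hx
  obtain ⟨z, -, hz⟩ := intermediate_value_uIcc h.continuous.continuousOn
    (Icc_subset_uIcc ⟨hx, hy.le⟩ : (0 : ℝ) ∈ uIcc (y x) (y x₀))
  have := hsq z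
  rw [hz] at this
  nlinarith [sq_pos_of_pos hy]

end IsSolution

/-! ### Linear differential equations -/

theorem abs_integral_exp_abs (x : ℝ) : |∫ s in (0 : ℝ)..x, Real.exp (|s|)| = Real.exp |x| - 1 := by
  wlog hx : 0 ≤ x generalizing x
  · have reflect := intervalIntegral.integral_comp_neg (fun s => Real.exp |s|) (a := 0) (b := x)
    simp only [abs_neg, neg_zero] at reflect
    rw [reflect, intervalIntegral.integral_symm, abs_neg, this (-x) (by linarith), abs_neg]
  have : ∫ s in (0 : ℝ)..x, Real.exp |s| = ∫ s in (0 : ℝ)..x, Real.exp s :=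
    intervalIntegral.integral_congr fun s hs => by
      rw [uIcc_of_le hx] at hs
      simp only [abs_of_nonneg hs.1]
  rw [this, integral_exp, Real.exp_zero, abs_of_nonneg hx, abs_of_nonneg]
  linarith [Real.one_le_exp hx]

section LinearODE

variable {E : Type*} [NormedAddCommGroup E] [NormedSpace ℝ E]

theorem norm_integral_le_mul_exp_abs {F : ℝ → E} {a : ℝ → ℝ} (ha : Continuous a) {C : ℝ}
    (hF : ∀ t, ‖F t‖ ≤ C * (Real.exp |∫ s in (0 : ℝ)..t, a s| * a t)) (hC : 0 ≤ C) (x : ℝ) :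
    ‖∫ t in (0 : ℝ)..x, F t‖ ≤ C * Real.exp |∫ s in (0 : ℝ)..x, a s| := by
  set m : ℝ → ℝ := fun x => ∫ s in (0 : ℝ)..x, a s with hm
  have hm' : ∀ x, HasDerivAt m (a x) x := fun x => (ha.integral_hasStrictDerivAt 0 x).hasDerivAt
  have hmc : Continuous m := continuous_iff_continuousAt.2 fun x => (hm' x).continuousAt
  calc ‖∫ t in (0 : ℝ)..x, F t‖
      ≤ |∫ t in (0 : ℝ)..x, C * (Real.exp |m t| * a t)| :=
        intervalIntegral.norm_integral_le_abs_of_norm_le (ae_of_all _ hF)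
          (Continuous.intervalIntegrable (by fun_prop) _ _)
    _ = C * |∫ s in m 0..m x, Real.exp (|s|)| := by
        rw [← intervalIntegral.integral_comp_mul_deriv (fun t _ => hm' t) ha.continuousOn
          (by fun_prop), intervalIntegral.integral_const_mul, abs_mul, abs_of_nonneg hC]
        rfl
    _ ≤ C * Real.exp |m x| := by
        have hm0 : m 0 = 0 := by simp [hm]
        rw [hm0, abs_integral_exp_abs]
        gcongr
        linarith

open scoped BoundedContinuousFunction in
theorem exists_weighted_volterra {A : ℝ → E →L[ℝ] E} (hA : Continuous A) {m : ℝ → ℝ}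
    (hm : ∀ x, m x = ∫ t in (0 : ℝ)..x, 2 * ‖A t‖) :
    ∃ K : (ℝ →ᵇ E) →L[ℝ] (ℝ →ᵇ E), ‖K‖ ≤ 1 / 2 ∧ ∀ Z x,
      K Z x = Real.exp (-|m x|) • ∫ t in (0 : ℝ)..x, Real.exp |m t| • A t (Z t) := by
  have hmc : Continuous m := by
    rw [funext hm]
    exact intervalIntegral.continuous_primitive
      (fun a b => Continuous.intervalIntegrable (by fun_prop) a b) 0
  have hint : ∀ (Z : ℝ →ᵇ E) (a b : ℝ),
      IntervalIntegrable (fun t => Real.exp |m t| • A t (Z t)) volume a b := fun Z a b =>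
    Continuous.intervalIntegrable (by fun_prop) a b
  have hbound : ∀ (Z : ℝ →ᵇ E) (x : ℝ),
      ‖Real.exp (-|m x|) • ∫ t in (0 : ℝ)..x, Real.exp |m t| • A t (Z t)‖ ≤ 1 / 2 * ‖Z‖ := by
    intro Z x
    have hle : ‖∫ t in (0 : ℝ)..x, Real.exp |m t| • A t (Z t)‖ ≤ ‖Z‖ / 2 * Real.exp |m x| := by
      rw [hm x]
      refine norm_integral_le_mul_exp_abs (by fun_prop) (fun t => ?_) (by positivity) x
      rw [← hm t, norm_smul, Real.norm_of_nonneg (Real.exp_pos _).le]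
      calc Real.exp |m t| * ‖A t (Z t)‖ ≤ Real.exp |m t| * (‖A t‖ * ‖Z‖) := by
            gcongr
            exact (A t).le_opNorm_of_le (Z.norm_coe_le_norm t)
        _ = _ := by ring
    rw [norm_smul, Real.norm_of_nonneg (Real.exp_pos _).le, Real.exp_neg,
      inv_mul_le_iff₀ (Real.exp_pos _)]
    linarith
  let K : (ℝ →ᵇ E) →ₗ[ℝ] (ℝ →ᵇ E) :=
    { toFun := fun Z => BoundedContinuousFunction.ofNormedAddCommGroup
        (fun x => Real.exp (-|m x|) • ∫ t in (0 : ℝ)..x, Real.exp |m t| • A t (Z t))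
        (Continuous.smul (by fun_prop) (intervalIntegral.continuous_primitive (hint Z) 0))
        (1 / 2 * ‖Z‖) (hbound Z)
      map_add' := fun Z W => by
        ext x
        simp [← smul_add, ← intervalIntegral.integral_add (hint Z 0 x) (hint W 0 x)]
      map_smul' := fun c Z => by
        ext x
        simp [smul_comm _ c] }
  exact ⟨K.mkContinuous (1 / 2) fun Z =>
      (BoundedContinuousFunction.norm_le (by positivity)).2 (hbound Z),
    K.mkContinuous_norm_le (by norm_num) _, fun Z x => rfl⟩

open scoped BoundedContinuousFunction in
theorem exists_linear_ode [CompleteSpace E] {A : ℝ → E →L[ℝ] E} (hA : Continuous A) (Y₀ : E) :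
    ∃ Y : ℝ → E, Y 0 = Y₀ ∧ ∀ t, HasDerivAt Y (A t (Y t)) t := by
  set m : ℝ → ℝ := fun x => ∫ t in (0 : ℝ)..x, 2 * ‖A t‖ with hm
  have hmc : Continuous m := intervalIntegral.continuous_primitive
    (fun a b => Continuous.intervalIntegrable (by fun_prop) a b) 0
  obtain ⟨K, hK, hK_apply⟩ := exists_weighted_volterra hA fun x => congrFun hm x
  let W : ℝ →ᵇ E := BoundedContinuousFunction.ofNormedAddCommGroup
    (fun x => Real.exp (-|m x|) • Y₀) (by fun_prop) ‖Y₀‖ fun x => by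
      rw [norm_smul, Real.norm_of_nonneg (Real.exp_pos _).le]
      exact mul_le_of_le_one_left (norm_nonneg _) (Real.exp_le_one_iff.2 (by simp))
  obtain ⟨Z, hZ⟩ : ∃ Z, Z - K Z = W :=
    ⟨(Units.oneSub K (by linarith)).inv W,
      congrArg (fun T : (ℝ →ᵇ E) →L[ℝ] (ℝ →ᵇ E) => T W) (Units.oneSub K (by linarith)).val_inv⟩
  have hY : ∀ x, Real.exp |m x| • Z x = Y₀ + ∫ t in (0 : ℝ)..x, Real.exp |m t| • A t (Z t) := by
    intro x
    have hZx : Z x = Real.exp (-|m x|) • Y₀ + K Z x := sub_eq_iff_eq_add.1 (DFunLike.congr_fun hZ x)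
    rw [hZx, hK_apply, ← smul_add, smul_smul, ← Real.exp_add, add_neg_cancel, Real.exp_zero,
      one_smul]
  refine ⟨fun x => Real.exp |m x| • Z x, by simp [hY], fun t => ?_⟩
  beta_reduce
  rw [map_smul, funext hY]
  have hc : Continuous fun t => Real.exp |m t| • A t (Z t) := by fun_prop
  exact (hc.integral_hasStrictDerivAt 0 t).hasDerivAt.const_add Y₀

end LinearODE

/-- The quasi-derivative `y' - Q y`, where `Q' = q`, turns the equation into a linear system whose
coefficients are continuous even though `q` is only locally integrable. -/
theorem IsSolution.exists_of_initial {q : ℝ → ℝ} (hq : LocallyIntegrable q volume) (a b : ℝ) :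
    ∃ y : ℝ → ℝ, IsSolution q 0 y ∧ y 0 = a ∧ deriv y 0 = b := by
  set Q : ℝ → ℝ := fun x => ∫ t in (0 : ℝ)..x, q t with hQ
  have hQac : LocallyAC Q :=
    .of_eq_add_integral (intervalIntegrable_of_locallyIntegrable hq) (by simp [hQ])
  have hQc : Continuous Q := hQac.continuous
  let A : ℝ → (ℝ × ℝ) →L[ℝ] (ℝ × ℝ) := fun t =>
    (ContinuousLinearMap.snd ℝ ℝ ℝ + Q t • ContinuousLinearMap.fst ℝ ℝ ℝ).prod
      (-(Q t • ContinuousLinearMap.snd ℝ ℝ ℝ) - Q t ^ 2 • ContinuousLinearMap.fst ℝ ℝ ℝ)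
  have hA : Continuous A := by
    refine continuous_clm_apply.2 fun y => ?_
    change Continuous fun t => (y.2 + Q t * y.1, -(Q t * y.2) - Q t ^ 2 * y.1)
    fun_prop
  obtain ⟨Y, hY0, hY⟩ := exists_linear_ode hA (a, b)
  have hfst : ∀ t, HasDerivAt (fun t => (Y t).1) ((Y t).2 + Q t * (Y t).1) t := fun t =>
    (hasFDerivAt_fst (p := Y t)).comp_hasDerivAt t (hY t)
  have hsnd : ∀ t, HasDerivAt (fun t => (Y t).2) (-(Q t * (Y t).2) - Q t ^ 2 * (Y t).1) t :=
    fun t => (hasFDerivAt_snd (p := Y t)).comp_hasDerivAt t (hY t)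
  have hYc : Continuous Y := continuous_iff_continuousAt.2 fun t => (hY t).continuousAt
  refine ⟨fun t => (Y t).1, .of_hasDerivAt hfst
    ((LocallyAC.of_hasDerivAt hsnd (by fun_prop)).add
      (hQac.mul (.of_hasDerivAt hfst (by fun_prop)))) ?_, by simp [hY0], ?_⟩
  · filter_upwards [_root_.LocallyIntegrable.ae_hasDerivAt_integral hq] with x hx
    convert! (hsnd x).add ((hx 0).mul (hfst x)) using 1
    simp only [Pi.zero_apply, hQ]
    ring
  · simp [(hfst 0).deriv, hY0, hQ]

/-! ### Positive solutions of the homogeneous equation -/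

/-- The standing assumptions on the coefficient `q` of `-y'' + q y = f`. -/
structure IsPotential (q : ℝ → ℝ) : Prop where
  locallyIntegrable : LocallyIntegrable q volume
  nonneg : ∀ᵐ x, 0 ≤ q x
  positiveTails : PositiveTails q

theorem IsPotential.intervalIntegrable {q : ℝ → ℝ} (hq : IsPotential q) (a b : ℝ) :
    IntervalIntegrable q volume a b :=
  intervalIntegrable_of_locallyIntegrable hq.locallyIntegrable a b

theorem IsPotential.not_ae_eq_zero {q : ℝ → ℝ} (hq : IsPotential q) : ¬∀ᵐ x, q x = 0 := fun h => by
  refine (hq.positiveTails 0).1.ne' ?_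
  rw [lintegral_congr_ae (g := 0), Pi.zero_def, lintegral_zero]
  filter_upwards [ae_restrict_of_ae h] with x hx
  simp [hx]

theorem exists_fundamental_system {q : ℝ → ℝ} (hq : LocallyIntegrable q volume)
    (hq0 : ∀ᵐ x, 0 ≤ q x) : ∃ c s : ℝ → ℝ, IsSolution q 0 c ∧ IsSolution q 0 s ∧
      (∀ x, c x * deriv s x - deriv c x * s x = 1) ∧ (∀ x, 0 < deriv s x) ∧
      (∀ z, 0 < z → 0 < s z) ∧ ∀ x z, 0 < c z * deriv s x - deriv c x * s z := by
  obtain ⟨c, hc, hc0, hc'0⟩ := IsSolution.exists_of_initial hq 1 0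
  obtain ⟨s, hs, hs0, hs'0⟩ := IsSolution.exists_of_initial hq 0 1
  have wronskian : ∀ x, c x * deriv s x - deriv c x * s x = 1 := fun x => by
    have := hc.wronskian_eq hs x 0
    rw [hc0, hc'0, hs0, hs'0] at this
    linarith
  -- As a function of `z` this is the solution with value `1` and derivative `0` at `x`.
  have kernel_pos : ∀ x z, 0 < c z * deriv s x - deriv c x * s z := fun x z => by
    have hsol := hc.comb hs (deriv s x) (-deriv c x)
    have := hsol.pos_of_deriv_eq_zero hq0 (x₀ := x)
      (by simp only [Pi.add_apply, Pi.smul_apply, smul_eq_mul]; linarith [wronskian x])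
      (by rw [hc.deriv_comb hs]; ring) z
    simp only [Pi.add_apply, Pi.smul_apply, smul_eq_mul] at this
    linarith
  have hs' : ∀ x, 0 < deriv s x := fun x => by simpa [hc0, hs0] using kernel_pos x 0
  exact ⟨c, s, hc, hs, wronskian, hs', fun z hz => hs0 ▸ strictMono_of_deriv_pos hs' hz,
    kernel_pos⟩

theorem exists_pos_antitone_solution {q : ℝ → ℝ} (hq : LocallyIntegrable q volume)
    (hq0 : ∀ᵐ x, 0 ≤ q x) :
    ∃ u : ℝ → ℝ, IsSolution q 0 u ∧ (∀ x, 0 < u x) ∧ ∀ x, deriv u x ≤ 0 := by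
  obtain ⟨c, s, hc, hs, wronskian, hs', hs_pos, kernel_pos⟩ := exists_fundamental_system hq hq0
  have ratio_le : ∀ x z, 0 < z → deriv c x / deriv s x ≤ c z / s z := fun x z hz => by
    rw [div_le_div_iff₀ (hs' x) (hs_pos z hz)]
    linarith [kernel_pos x z]
  obtain ⟨k, hk, hk'⟩ : ∃ k, (∀ z, 0 < z → k ≤ c z / s z) ∧ ∀ x, deriv c x / deriv s x ≤ k := by
    refine ⟨sInf ((fun z => c z / s z) '' Ioi 0), fun z hz => csInf_le ?_ ⟨z, hz, rfl⟩,
      fun x => le_csInf (nonempty_Ioi.image _) (forall_mem_image.2 fun z hz => ratio_le x z hz)⟩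
    exact ⟨_, forall_mem_image.2 fun z hz => ratio_le 0 z hz⟩
  set u := (1 : ℝ) • c + (-k) • s with hu_def
  have hu_apply : ∀ x, u x = c x - k * s x := fun x => by
    simp only [hu_def, Pi.add_apply, Pi.smul_apply, smul_eq_mul]; ring
  have hu'_apply : ∀ x, deriv u x = deriv c x - k * deriv s x := fun x => by
    rw [hu_def, hc.deriv_comb hs]; ring
  have hu : IsSolution q 0 u := hc.comb hs 1 (-k)
  have hu' : ∀ x, deriv u x ≤ 0 := fun x => by
    rw [hu'_apply]
    linarith [(div_le_iff₀ (hs' x)).1 (hk' x)]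
  have hu_nonneg : ∀ x, 0 ≤ u x := fun x => by
    refine le_trans ?_ (antitone_of_deriv_nonpos hu.1 hu' (le_max_left x 1))
    have hz : 0 < max x 1 := by positivity
    rw [hu_apply]
    linarith [(le_div_iff₀ (hs_pos _ hz)).1 (hk _ hz)]
  refine ⟨u, hu, fun x => (hu_nonneg x).lt_of_ne' fun hx => ?_, hu'⟩
  have hx' : deriv u x = 0 :=
    IsLocalMin.deriv_eq_zero (Eventually.of_forall fun z => hx ▸ hu_nonneg z)
  rw [hu_apply] at hx
  rw [hu'_apply] at hx'
  have : c x * deriv s x - deriv c x * s x = 0 := by linear_combination deriv s x * hx - s x * hx'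
  linarith [wronskian x]

theorem exists_pos_monotone_solution {q : ℝ → ℝ} (hq : LocallyIntegrable q volume)
    (hq0 : ∀ᵐ x, 0 ≤ q x) :
    ∃ v : ℝ → ℝ, IsSolution q 0 v ∧ (∀ x, 0 < v x) ∧ ∀ x, 0 ≤ deriv v x := by
  have hq_neg : LocallyIntegrable (fun x => q (-x)) volume := by
    rw [← Measure.map_neg_eq_self (volume : Measure ℝ)] at hq
    exact (locallyIntegrable_map_homeomorph (Homeomorph.neg ℝ)).1 hq
  have hq0_neg : ∀ᵐ x, 0 ≤ q (-x) :=
    (Measure.measurePreserving_neg volume).quasiMeasurePreserving.ae hq0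
  obtain ⟨u, hu, hu_pos, hu'⟩ := exists_pos_antitone_solution hq_neg hq0_neg
  refine ⟨fun x => u (-x), by simpa only [neg_neg] using! hu.comp_neg, fun x => hu_pos _,
    fun x => ?_⟩
  rw [deriv_comp_neg]
  linarith [hu' (-x)]

/-- A positive nonincreasing solution `u` and a positive nondecreasing solution `v` of
`-y'' + q y = 0`, normalised by `v' u - u' v = 1`; the operator `-d²/dx² + q` is inverted by means
of this pair. -/
structure PrincipalPair (q u v : ℝ → ℝ) : Prop where
  isSolution_u : IsSolution q 0 u
  isSolution_v : IsSolution q 0 v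
  u_pos : ∀ x, 0 < u x
  v_pos : ∀ x, 0 < v x
  deriv_u_nonpos : ∀ x, deriv u x ≤ 0
  deriv_v_nonneg : ∀ x, 0 ≤ deriv v x
  wronskian : ∀ x, deriv v x * u x - deriv u x * v x = 1

theorem IsPotential.exists_principalPair {q : ℝ → ℝ} (hq : IsPotential q) :
    ∃ u v : ℝ → ℝ, PrincipalPair q u v := by
  obtain ⟨u, hu, hu_pos, hu'⟩ := exists_pos_antitone_solution hq.locallyIntegrable hq.nonneg
  obtain ⟨v, hv, hv_pos, hv'⟩ := exists_pos_monotone_solution hq.locallyIntegrable hq.nonneg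
  set W := deriv v 0 * u 0 - v 0 * deriv u 0
  have hW : ∀ x, deriv v x * u x - v x * deriv u x = W := fun x => hv.wronskian_eq hu x 0
  have hvu : ∀ x, 0 ≤ deriv v x * u x := fun x => mul_nonneg (hv' x) (hu_pos x).le
  have huv : ∀ x, v x * deriv u x ≤ 0 := fun x =>
    mul_nonpos_of_nonneg_of_nonpos (hv_pos x).le (hu' x)
  have hW_pos : 0 < W := by
    refine (by linarith [hvu 0, huv 0] : 0 ≤ W).lt_of_ne' fun hW0 => hq.not_ae_eq_zero ?_
    have hu'0 : deriv u = 0 := funext fun x => by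
      have : v x * deriv u x = 0 := by linarith [hW x, hvu x, huv x]
      exact (mul_eq_zero.1 this).resolve_left (hv_pos x).ne'
    filter_upwards [hu.ae_hasDerivAt_deriv] with x hx
    rw [hu'0] at hx
    have := hx.unique (hasDerivAt_const x 0)
    simp only [Pi.zero_apply, sub_zero] at this
    exact (mul_eq_zero.1 this).resolve_right (hu_pos x).ne'
  have hv_smul : ∀ x, deriv (W⁻¹ • v) x = W⁻¹ * deriv v x := fun x =>
    ((hv.hasDerivAt x).const_smul W⁻¹).deriv
  refine ⟨u, W⁻¹ • v, hu, by simpa using hv.const_smul W⁻¹, hu_pos,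
    fun x => mul_pos (inv_pos.2 hW_pos) (hv_pos x), hu', fun x => ?_, fun x => ?_⟩
  · rw [hv_smul]
    exact mul_nonneg (inv_pos.2 hW_pos).le (hv' x)
  · rw [hv_smul, Pi.smul_apply, smul_eq_mul, ← inv_mul_cancel₀ hW_pos.ne', ← hW x]
    ring

/-! ### Averaging windows -/

/-- The mass of `q` on the symmetric window `[x - t, x + t]`. -/
noncomputable def windowMass (q : ℝ → ℝ) (x t : ℝ) : ℝ :=
  ∫ ξ in (x - t)..(x + t), q ξ

/-- The half-width `√2 d(x)` of the window over which the definition of `d(x)` averages `q`. -/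
noncomputable def windowRadius (q : ℝ → ℝ) (x : ℝ) : ℝ :=
  √2 * averagingRadius q x

theorem continuous_windowMass {q : ℝ → ℝ} (hq : ∀ a b, IntervalIntegrable q volume a b) (x : ℝ) :
    Continuous (windowMass q x) := by
  have hprim : Continuous fun b : ℝ => ∫ ξ in (0 : ℝ)..b, q ξ :=
    intervalIntegral.continuous_primitive hq 0
  have heq : windowMass q x =
      fun t => (∫ ξ in (0 : ℝ)..(x + t), q ξ) - ∫ ξ in (0 : ℝ)..(x - t), q ξ :=
    funext fun t => (intervalIntegral.integral_interval_sub_left (hq _ _) (hq _ _)).symm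
  rw [heq]
  exact (hprim.comp (by fun_prop)).sub (hprim.comp (by fun_prop))

namespace IsPotential

variable {q : ℝ → ℝ}

theorem averagingRadius_pos (hq : IsPotential q) (x : ℝ) : 0 < averagingRadius q x :=
  (averagingRadius_spec q hq.locallyIntegrable hq.nonneg hq.positiveTails x).1

theorem windowRadius_pos (hq : IsPotential q) (x : ℝ) : 0 < windowRadius q x :=
  mul_pos (by positivity) (hq.averagingRadius_pos x)

theorem integral_windowMass_eq_two (hq : IsPotential q) (x : ℝ) :
    ∫ t in (0 : ℝ)..windowRadius q x, windowMass q x t = 2 :=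
  (averagingRadius_spec q hq.locallyIntegrable hq.nonneg hq.positiveTails x).2

theorem intervalIntegrable_windowMass (hq : IsPotential q) (x a b : ℝ) :
    IntervalIntegrable (windowMass q x) volume a b :=
  (continuous_windowMass hq.intervalIntegrable x).intervalIntegrable a b

theorem windowMass_le_windowMass (hq : IsPotential q) {x x' s t : ℝ} (hs : 0 ≤ s)
    (hst : |x - x'| + s ≤ t) : windowMass q x s ≤ windowMass q x' t := by
  have := abs_le.1 (le_refl |x - x'|)
  exact intervalIntegral.integral_mono_interval (by linarith) (by linarith) (by linarith)
    (ae_restrict_of_ae hq.nonneg) (hq.intervalIntegrable _ _)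

theorem windowMass_mono (hq : IsPotential q) (x : ℝ) {s t : ℝ} (hs : 0 ≤ s) (hst : s ≤ t) :
    windowMass q x s ≤ windowMass q x t :=
  hq.windowMass_le_windowMass hs (by simpa using hst)

theorem windowMass_nonneg (hq : IsPotential q) (x : ℝ) {t : ℝ} (ht : 0 ≤ t) :
    0 ≤ windowMass q x t :=
  intervalIntegral.integral_nonneg_of_ae (by linarith) hq.nonneg

theorem mul_windowMass_le_integral (hq : IsPotential q) (x : ℝ) {a b : ℝ} (ha : 0 ≤ a)
    (hab : a ≤ b) : (b - a) * windowMass q x a ≤ ∫ t in a..b, windowMass q x t := by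
  have := intervalIntegral.integral_mono_on hab intervalIntegrable_const
    (hq.intervalIntegrable_windowMass x a b) fun t ht => hq.windowMass_mono x ha ht.1
  simpa using this

theorem integral_windowMass_le_mul (hq : IsPotential q) (x : ℝ) {b : ℝ} (hb : 0 ≤ b) :
    ∫ t in (0 : ℝ)..b, windowMass q x t ≤ b * windowMass q x b := by
  have := intervalIntegral.integral_mono_on hb (hq.intervalIntegrable_windowMass x 0 b)
    intervalIntegrable_const fun t ht => hq.windowMass_mono x ht.1 ht.2
  simpa using this

theorem integral_windowMass_quarter_le (hq : IsPotential q) (x : ℝ) :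
    ∫ t in (0 : ℝ)..(windowRadius q x / 4), windowMass q x t ≤ 1 / 2 := by
  have hs := hq.windowRadius_pos x
  have inner := hq.integral_windowMass_le_mul x (b := windowRadius q x / 4) (by positivity)
  have outer := hq.mul_windowMass_le_integral x (a := windowRadius q x / 4) (b := windowRadius q x)
    (by positivity) (by linarith)
  have := intervalIntegral.integral_add_adjacent_intervals
    (hq.intervalIntegrable_windowMass x 0 (windowRadius q x / 4))
    (hq.intervalIntegrable_windowMass x _ (windowRadius q x))
  linarith [hq.integral_windowMass_eq_two x]

theorem windowRadius_le_of_two_le (hq : IsPotential q) {x r : ℝ} (hr : 0 ≤ r)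
    (h : 2 ≤ ∫ t in (0 : ℝ)..r, windowMass q x t) : windowRadius q x ≤ r := by
  by_contra! hlt
  have inner := hq.integral_windowMass_le_mul x hr
  have outer := hq.mul_windowMass_le_integral x hr hlt.le
  have split := intervalIntegral.integral_add_adjacent_intervals
    (hq.intervalIntegrable_windowMass x 0 r)
    (hq.intervalIntegrable_windowMass x r (windowRadius q x))
  rw [hq.integral_windowMass_eq_two x] at split
  have hmass : windowMass q x r ≤ 0 :=
    nonpos_of_mul_nonpos_right (by linarith) (sub_pos.2 hlt)
  linarith [mul_nonpos_of_nonneg_of_nonpos hr hmass]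

theorem windowRadius_le_add (hq : IsPotential q) (x x' : ℝ) :
    windowRadius q x' ≤ windowRadius q x + |x - x'| := by
  set s := windowRadius q x
  set δ := |x - x'|
  have hδ : 0 ≤ δ := abs_nonneg _
  have hs : 0 < s := hq.windowRadius_pos x
  have hcont : Continuous (windowMass q x') := continuous_windowMass hq.intervalIntegrable x'
  refine hq.windowRadius_le_of_two_le (by positivity) ?_
  calc (2 : ℝ) = ∫ t in (0 : ℝ)..s, windowMass q x t := (hq.integral_windowMass_eq_two x).symm
    _ ≤ ∫ t in (0 : ℝ)..s, windowMass q x' (t + δ) :=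
        intervalIntegral.integral_mono_on hs.le (hq.intervalIntegrable_windowMass x _ _)
          (Continuous.intervalIntegrable (by fun_prop) _ _)
          fun t ht => hq.windowMass_le_windowMass ht.1 (add_comm _ _).le
    _ = ∫ t in δ..(s + δ), windowMass q x' t := by
        rw [intervalIntegral.integral_comp_add_right (windowMass q x'), zero_add]
    _ ≤ ∫ t in (0 : ℝ)..(s + δ), windowMass q x' t := by
        rw [← intervalIntegral.integral_add_adjacent_intervals
          (hq.intervalIntegrable_windowMass x' 0 δ) (hq.intervalIntegrable_windowMass x' δ (s + δ))]
        exact le_add_of_nonneg_left (intervalIntegral.integral_nonneg hδ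
          fun t ht => hq.windowMass_nonneg x' ht.1)

theorem averagingRadius_le_add (hq : IsPotential q) (x x' : ℝ) :
    averagingRadius q x' ≤ averagingRadius q x + |x - x'| := by
  have hδ : |x - x'| ≤ √2 * |x - x'| :=
    le_mul_of_one_le_left (abs_nonneg _) (Real.one_le_sqrt.2 one_le_two)
  have := hq.windowRadius_le_add x x'
  simp only [windowRadius] at this
  refine le_of_mul_le_mul_left ?_ (by positivity : 0 < √2)
  linarith

theorem continuous_averagingRadius (hq : IsPotential q) : Continuous (averagingRadius q) :=
  (LipschitzWith.of_le_add fun x y => by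
    rw [Real.dist_eq, abs_sub_comm]; exact hq.averagingRadius_le_add y x).continuous

end IsPotential

/-! ### The Green function on the diagonal -/

/-- The Green function of `-d²/dx² + q` built from the solutions `u` (nonincreasing) and `v`
(nondecreasing). -/
def green (u v : ℝ → ℝ) (x t : ℝ) : ℝ :=
  u (max x t) * v (min x t)

section Green

variable {u v : ℝ → ℝ} {x t : ℝ}

theorem green_comm (u v : ℝ → ℝ) (x t : ℝ) : green u v x t = green u v t x := by
  rw [green, green, max_comm, min_comm]

theorem green_of_le (h : x ≤ t) : green u v x t = u t * v x := by
  rw [green, max_eq_right h, min_eq_left h]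

theorem green_of_ge (h : t ≤ x) : green u v x t = u x * v t := by
  rw [green, max_eq_left h, min_eq_right h]

end Green

namespace IsSolution

variable {q y : ℝ → ℝ}

theorem convexOn (h : IsSolution q 0 y) (hq : ∀ᵐ x, 0 ≤ q x) (hy : ∀ x, 0 ≤ y x) :
    ConvexOn ℝ univ y :=
  (h.monotone_deriv hq hy).convexOn_univ_of_deriv h.1

theorem add_deriv_mul_le (h : IsSolution q 0 y) (hq : ∀ᵐ x, 0 ≤ q x) (hy : ∀ x, 0 ≤ y x)
    (a b : ℝ) : y a + deriv y a * (b - a) ≤ y b :=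
  add_deriv_mul_sub_le h.hasDerivAt (h.monotone_deriv hq hy) a b

theorem mul_integral_le_deriv_sub (h : IsSolution q 0 y) (hq : IsPotential q) {a b m : ℝ}
    (hab : a ≤ b) (hm : ∀ ξ ∈ Icc a b, m ≤ y ξ) :
    m * ∫ ξ in a..b, q ξ ≤ deriv y b - deriv y a := by
  rw [← h.integral_eq_deriv_sub, mul_comm, ← intervalIntegral.integral_mul_const]
  refine intervalIntegral.integral_mono_ae_restrict hab ((hq.intervalIntegrable a b).mul_const m)
    ((hq.intervalIntegrable a b).mul_continuousOn h.continuous.continuousOn) ?_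
  filter_upwards [ae_restrict_of_ae hq.nonneg, ae_restrict_mem measurableSet_Icc] with ξ hξ hmem
  exact mul_le_mul_of_nonneg_left (hm ξ hmem) hξ

theorem deriv_sub_le_mul_integral (h : IsSolution q 0 y) (hq : IsPotential q) {a b M : ℝ}
    (hab : a ≤ b) (hM : ∀ ξ ∈ Icc a b, y ξ ≤ M) :
    deriv y b - deriv y a ≤ M * ∫ ξ in a..b, q ξ := by
  have hneg : IsSolution q 0 ((-1 : ℝ) • y) := by simpa using h.const_smul (-1)
  have hderiv : ∀ x, deriv ((-1 : ℝ) • y) x = -deriv y x := fun x => by simp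
  have := hneg.mul_integral_le_deriv_sub hq (m := -M) hab (by simpa using hM)
  rw [hderiv, hderiv] at this
  linarith

theorem second_difference_eq (h : IsSolution q 0 y) (x τ : ℝ) :
    y (x + τ) + y (x - τ) - 2 * y x = ∫ t in (0 : ℝ)..τ, (deriv y (x + t) - deriv y (x - t)) := by
  have hderiv : ∀ t, HasDerivAt (fun t => y (x + t) + y (x - t))
      (deriv y (x + t) - deriv y (x - t)) t := fun t => by
    simpa only [sub_eq_add_neg] using! ((h.hasDerivAt _).comp_const_add x t).add
      ((h.hasDerivAt _).comp_const_sub x t)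
  have hy' := h.continuous_deriv
  rw [intervalIntegral.integral_eq_sub_of_hasDerivAt (fun t _ => hderiv t)
    (Continuous.intervalIntegrable (by fun_prop) _ _)]
  simp only [add_zero, sub_zero]
  ring

/-- On a quarter of the averaging window `q` carries too little mass for `y` to grow by more than
a constant factor. -/
theorem add_quarter_window_le (h : IsSolution q 0 y) (hq : IsPotential q) (hy : ∀ x, 0 ≤ y x)
    (x : ℝ) : y (x + windowRadius q x / 4) + y (x - windowRadius q x / 4) ≤ 4 * y x := by
  set τ := windowRadius q x / 4
  set M := y (x + τ) + y (x - τ)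
  have hτ : 0 < τ := div_pos (hq.windowRadius_pos x) four_pos
  have hM : 0 ≤ M := add_nonneg (hy _) (hy _)
  have hyM : ∀ ξ ∈ Icc (x - τ) (x + τ), y ξ ≤ M := fun ξ hξ =>
    ((h.convexOn hq.nonneg hy).le_max_of_mem_Icc (mem_univ _) (mem_univ _) hξ).trans
      (max_le (le_add_of_nonneg_left (hy _)) (le_add_of_nonneg_right (hy _)))
  have hy' := h.continuous_deriv
  have : M - 2 * y x ≤ M * (1 / 2) := calc
    M - 2 * y x = ∫ t in (0 : ℝ)..τ, (deriv y (x + t) - deriv y (x - t)) :=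
        h.second_difference_eq x τ
    _ ≤ ∫ t in (0 : ℝ)..τ, M * windowMass q x t :=
        intervalIntegral.integral_mono_on hτ.le (Continuous.intervalIntegrable (by fun_prop) _ _)
          ((hq.intervalIntegrable_windowMass x _ _).const_mul M) fun t ht =>
            h.deriv_sub_le_mul_integral hq (by linarith [ht.1]) fun ξ hξ =>
              hyM ξ ⟨by linarith [hξ.1, ht.2], by linarith [hξ.2, ht.2]⟩
    _ ≤ M * (1 / 2) := by
        rw [intervalIntegral.integral_const_mul]
        exact mul_le_mul_of_nonneg_left (hq.integral_windowMass_quarter_le x) hM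
  linarith

theorem abs_deriv_mul_windowRadius_le (h : IsSolution q 0 y) (hq : IsPotential q)
    (hy : ∀ x, 0 ≤ y x) (x : ℝ) : |deriv y x| * windowRadius q x ≤ 12 * y x := by
  set s := windowRadius q x
  have growth := h.add_quarter_window_le hq hy x
  have right := h.add_deriv_mul_le hq.nonneg hy x (x + s / 4)
  have left := h.add_deriv_mul_le hq.nonneg hy x (x - s / 4)
  rcases abs_cases (deriv y x) with ⟨habs, -⟩ | ⟨habs, -⟩
  · rw [habs]
    linarith [hy (x - s / 4)]
  · rw [habs]
    linarith [hy (x + s / 4)]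

end IsSolution

namespace PrincipalPair

variable {q u v : ℝ → ℝ}

theorem antitone_u (h : PrincipalPair q u v) : Antitone u :=
  antitone_of_deriv_nonpos h.isSolution_u.1 h.deriv_u_nonpos

theorem monotone_v (h : PrincipalPair q u v) : Monotone v :=
  monotone_of_deriv_nonneg h.isSolution_v.1 h.deriv_v_nonneg

theorem deriv_v_mul_u_le_one (h : PrincipalPair q u v) (x : ℝ) : deriv v x * u x ≤ 1 := by
  linarith [h.wronskian x, mul_nonpos_of_nonpos_of_nonneg (h.deriv_u_nonpos x) (h.v_pos x).le]

theorem neg_one_le_deriv_u_mul_v (h : PrincipalPair q u v) (x : ℝ) : -1 ≤ deriv u x * v x := by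
  linarith [h.wronskian x, mul_nonneg (h.deriv_v_nonneg x) (h.u_pos x).le]

theorem green_pos (h : PrincipalPair q u v) (x t : ℝ) : 0 < green u v x t :=
  mul_pos (h.u_pos _) (h.v_pos _)

theorem diag_pos (h : PrincipalPair q u v) (x : ℝ) : 0 < u x * v x :=
  mul_pos (h.u_pos x) (h.v_pos x)

theorem diag_sub_abs_le_green (h : PrincipalPair q u v) (hq : ∀ᵐ x, 0 ≤ q x) (x t : ℝ) :
    u x * v x - |t - x| ≤ green u v x t := by
  rcases le_total x t with hxt | hxt
  · have tangent := h.isSolution_u.add_deriv_mul_le hq (fun z => (h.u_pos z).le) x t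
    rw [green_of_le hxt, abs_of_nonneg (sub_nonneg.2 hxt)]
    nlinarith [mul_le_mul_of_nonneg_right tangent (h.v_pos x).le, h.neg_one_le_deriv_u_mul_v x]
  · have tangent := h.isSolution_v.add_deriv_mul_le hq (fun z => (h.v_pos z).le) x t
    rw [green_of_ge hxt, abs_of_nonpos (sub_nonpos.2 hxt)]
    nlinarith [mul_le_mul_of_nonneg_left tangent (h.u_pos x).le, h.deriv_v_mul_u_le_one x]

theorem diag_sub_mul_windowMass_le_one (h : PrincipalPair q u v) (hq : IsPotential q) (x : ℝ)
    {t : ℝ} (ht : 0 ≤ t) : (u x * v x - t) * windowMass q x t ≤ 1 := by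
  have hu := h.u_pos x
  have hv := h.v_pos x
  have hgreen : ∀ {ξ}, |ξ - x| ≤ t → u x * v x - t ≤ green u v x ξ := fun {ξ} hξ =>
    (sub_le_sub_left hξ _).trans (h.diag_sub_abs_le_green hq.nonneg x ξ)
  have right : (u x * v x - t) * ∫ ξ in x..(x + t), q ξ ≤ -(deriv u x * v x) := by
    have := h.isSolution_u.mul_integral_le_deriv_sub hq (a := x) (b := x + t)
      (m := (u x * v x - t) / v x) (by linarith) fun ξ hξ => by
        rw [div_le_iff₀ hv, ← green_of_le hξ.1]
        exact hgreen (abs_le.2 ⟨by linarith [hξ.1], by linarith [hξ.2]⟩)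
    rw [div_mul_eq_mul_div, div_le_iff₀ hv] at this
    nlinarith [h.deriv_u_nonpos (x + t)]
  have left : (u x * v x - t) * ∫ ξ in (x - t)..x, q ξ ≤ deriv v x * u x := by
    have := h.isSolution_v.mul_integral_le_deriv_sub hq (a := x - t) (b := x)
      (m := (u x * v x - t) / u x) (by linarith) fun ξ hξ => by
        rw [div_le_iff₀' hu, ← green_of_ge hξ.2]
        exact hgreen (abs_le.2 ⟨by linarith [hξ.1], by linarith [hξ.2]⟩)
    rw [div_mul_eq_mul_div, div_le_iff₀ hu] at this
    nlinarith [h.deriv_v_nonneg (x - t)]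
  rw [windowMass, ← intervalIntegral.integral_add_adjacent_intervals
    (hq.intervalIntegrable _ x) (hq.intervalIntegrable x _)]
  linarith [h.wronskian x]

theorem diag_le (h : PrincipalPair q u v) (hq : IsPotential q) (x : ℝ) :
    u x * v x ≤ 3 * averagingRadius q x := by
  set s := windowRadius q x
  have hs : 0 < s := hq.windowRadius_pos x
  have : (u x * v x - s) * 2 ≤ s := calc
    (u x * v x - s) * 2 = ∫ t in (0 : ℝ)..s, (u x * v x - s) * windowMass q x t := by
        rw [intervalIntegral.integral_const_mul, hq.integral_windowMass_eq_two]
    _ ≤ ∫ _ in (0 : ℝ)..s, (1 : ℝ) :=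
        intervalIntegral.integral_mono_on hs.le
          ((hq.intervalIntegrable_windowMass x _ _).const_mul _) intervalIntegrable_const
          fun t ht => (mul_le_mul_of_nonneg_right (sub_le_sub_left ht.2 _)
            (hq.windowMass_nonneg x ht.1)).trans (h.diag_sub_mul_windowMass_le_one hq x ht.1)
    _ = s := by simp
  have hs_le : s ≤ 2 * averagingRadius q x :=
    mul_le_mul_of_nonneg_right (Real.sqrt_le_iff.2 ⟨zero_le_two, by norm_num⟩)
      (hq.averagingRadius_pos x).le
  linarith

theorem le_diag (h : PrincipalPair q u v) (hq : IsPotential q) (x : ℝ) :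
    averagingRadius q x / 24 ≤ u x * v x := by
  have hu := h.isSolution_u.abs_deriv_mul_windowRadius_le hq (fun z => (h.u_pos z).le) x
  have hv := h.isSolution_v.abs_deriv_mul_windowRadius_le hq (fun z => (h.v_pos z).le) x
  rw [abs_of_nonpos (h.deriv_u_nonpos x)] at hu
  rw [abs_of_nonneg (h.deriv_v_nonneg x)] at hv
  have hs_le : averagingRadius q x ≤ windowRadius q x :=
    le_mul_of_one_le_left (hq.averagingRadius_pos x).le (Real.one_le_sqrt.2 one_le_two)
  have : windowRadius q x ≤ 24 * (u x * v x) := calc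
    windowRadius q x = (deriv v x * windowRadius q x) * u x
        + (-deriv u x * windowRadius q x) * v x := by
          linear_combination -windowRadius q x * h.wronskian x
    _ ≤ 12 * v x * u x + 12 * u x * v x :=
        add_le_add (mul_le_mul_of_nonneg_right hv (h.u_pos x).le)
          (mul_le_mul_of_nonneg_right hu (h.v_pos x).le)
    _ = 24 * (u x * v x) := by ring
  linarith

end PrincipalPair

/-! ### The averaging distance and the decay of the Green function -/

theorem averagingDist_comm (q : ℝ → ℝ) (x t : ℝ) : averagingDist q x t = averagingDist q t x := by
  rw [averagingDist, averagingDist, intervalIntegral.integral_symm, abs_neg]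

theorem log_le_abs_integral_one_div {f : ℝ → ℝ} {c : ℝ} (hf : Continuous f) (hf0 : ∀ x, 0 < f x)
    (hc : 0 < c) (hfc : ∀ x, f x ≤ c + |x|) (t : ℝ) :
    Real.log (1 + |t| / c) ≤ |∫ ξ in (0 : ℝ)..t, 1 / f ξ| := by
  wlog ht : 0 ≤ t generalizing f t
  · have := this (f := fun x => f (-x)) (by fun_prop) (fun x => hf0 _)
      (fun x => by simpa using hfc (-x)) (-t) (by linarith)
    rwa [abs_neg, intervalIntegral.integral_comp_neg fun x => 1 / f x, neg_neg, neg_zero,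
      intervalIntegral.integral_symm, abs_neg] at this
  have hderiv : ∀ ξ ∈ uIcc 0 t, HasDerivAt (fun ξ => Real.log (c + ξ)) (1 / (c + ξ)) ξ := by
    intro ξ hξ
    rw [uIcc_of_le ht] at hξ
    exact ((hasDerivAt_id ξ).const_add c).log (add_pos_of_pos_of_nonneg hc hξ.1).ne'
  have hcont : ContinuousOn (fun ξ => 1 / (c + ξ)) (uIcc 0 t) := by
    rw [uIcc_of_le ht]
    exact continuousOn_const.div (by fun_prop) fun ξ hξ =>
      (add_pos_of_pos_of_nonneg hc hξ.1).ne'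
  refine le_trans ?_ (le_abs_self _)
  calc Real.log (1 + |t| / c) = ∫ ξ in (0 : ℝ)..t, 1 / (c + ξ) := by
        rw [intervalIntegral.integral_eq_sub_of_hasDerivAt hderiv hcont.intervalIntegrable,
          add_zero, ← Real.log_div (by positivity) hc.ne', abs_of_nonneg ht, add_div,
          div_self hc.ne']
    _ ≤ ∫ ξ in (0 : ℝ)..t, 1 / f ξ :=
        intervalIntegral.integral_mono_on ht hcont.intervalIntegrable
          ((continuous_const.div hf fun x => (hf0 x).ne').intervalIntegrable _ _) fun ξ hξ =>
            one_div_le_one_div_of_le (hf0 ξ) (by simpa [abs_of_nonneg hξ.1] using hfc ξ)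

namespace IsPotential

variable {q : ℝ → ℝ}

theorem intervalIntegrable_one_div_averagingRadius (hq : IsPotential q) (a b : ℝ) :
    IntervalIntegrable (fun ξ => 1 / averagingRadius q ξ) volume a b :=
  (continuous_const.div hq.continuous_averagingRadius
    fun x => (hq.averagingRadius_pos x).ne').intervalIntegrable a b

theorem averagingDist_of_le (hq : IsPotential q) {x t : ℝ} (hxt : x ≤ t) :
    averagingDist q x t = ∫ ξ in x..t, 1 / averagingRadius q ξ :=
  abs_of_nonneg (intervalIntegral.integral_nonneg hxt
    fun ξ _ => (one_div_pos.2 (hq.averagingRadius_pos ξ)).le)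

theorem tendsto_averagingDist (hq : IsPotential q) :
    Tendsto (averagingDist q 0) (cocompact ℝ) atTop := by
  have hd := hq.averagingRadius_pos 0
  refine tendsto_atTop_mono
    (log_le_abs_integral_one_div hq.continuous_averagingRadius hq.averagingRadius_pos hd
      fun x => by simpa using hq.averagingRadius_le_add 0 x)
    (Real.tendsto_log_atTop.comp (tendsto_atTop_add_const_left _ _ ?_))
  exact tendsto_norm_cocompact_atTop.atTop_div_const hd

theorem half_le_averagingRadius (hq : IsPotential q) {x t : ℝ}
    (h : |t - x| ≤ averagingRadius q x / 2) : averagingRadius q x / 2 ≤ averagingRadius q t := by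
  linarith [hq.averagingRadius_le_add t x]

theorem averagingRadius_le_two_mul (hq : IsPotential q) {x t : ℝ}
    (h : |t - x| ≤ averagingRadius q x / 2) : averagingRadius q t ≤ 2 * averagingRadius q x := by
  rw [abs_sub_comm] at h
  linarith [hq.averagingRadius_le_add x t, hq.averagingRadius_pos x]

theorem averagingDist_le_one (hq : IsPotential q) {x t : ℝ}
    (h : |t - x| ≤ averagingRadius q x / 2) : averagingDist q x t ≤ 1 := by
  have hd := hq.averagingRadius_pos x
  have := intervalIntegral.norm_integral_le_of_norm_le_const (a := x) (b := t)
    (f := fun ξ => 1 / averagingRadius q ξ) (C := 1 / (averagingRadius q x / 2)) fun ξ hξ => by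
      rw [Real.norm_of_nonneg (one_div_pos.2 (hq.averagingRadius_pos ξ)).le]
      exact one_div_le_one_div_of_le (half_pos hd) (hq.half_le_averagingRadius
        ((abs_sub_left_of_mem_uIcc (uIoc_subset_uIcc hξ)).trans h))
  refine this.trans ?_
  rwa [one_div_mul_eq_div, div_le_one (half_pos hd)]

end IsPotential

namespace PrincipalPair

variable {q u v : ℝ → ℝ}

theorem sq_green_of_le (h : PrincipalPair q u v) {x t : ℝ} (hxt : x ≤ t) :
    green u v x t ^ 2 =
      (u x * v x) * (u t * v t) * Real.exp (-∫ ξ in x..t, 1 / (u ξ * v ξ)) := by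
  have hu := fun ξ => (h.u_pos ξ).ne'
  have hv := fun ξ => (h.v_pos ξ).ne'
  have hderiv : ∀ ξ, HasDerivAt (fun ξ => Real.log (v ξ) - Real.log (u ξ))
      (1 / (u ξ * v ξ)) ξ := fun ξ => by
    convert! ((h.isSolution_v.hasDerivAt ξ).log (hv ξ)).sub
      ((h.isSolution_u.hasDerivAt ξ).log (hu ξ)) using 1
    have := hu ξ
    have := hv ξ
    field_simp
    linarith [h.wronskian ξ]
  have hcont : Continuous fun ξ => 1 / (u ξ * v ξ) :=
    continuous_const.div (h.isSolution_u.continuous.mul h.isSolution_v.continuous)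
      fun ξ => (h.diag_pos ξ).ne'
  rw [green_of_le hxt, intervalIntegral.integral_eq_sub_of_hasDerivAt (fun ξ _ => hderiv ξ)
    (hcont.intervalIntegrable _ _), ← Real.log_div (hv t) (hu t), ← Real.log_div (hv x) (hu x),
    neg_sub, Real.exp_sub, Real.exp_log (div_pos (h.v_pos x) (h.u_pos x)),
    Real.exp_log (div_pos (h.v_pos t) (h.u_pos t))]
  have := hu x
  have := hv t
  field_simp

theorem green_le (h : PrincipalPair q u v) (hq : IsPotential q) (x t : ℝ) :
    green u v x t ≤ 3 * √(averagingRadius q x) * √(averagingRadius q t) *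
      Real.exp (-(1 / 6) * averagingDist q x t) := by
  wlog hxt : x ≤ t generalizing x t
  · rw [green_comm, averagingDist_comm, mul_right_comm 3]
    exact this t x (le_of_not_ge hxt)
  have hd := hq.averagingRadius_pos
  have hdist : 1 / 3 * averagingDist q x t ≤ ∫ ξ in x..t, 1 / (u ξ * v ξ) := by
    rw [hq.averagingDist_of_le hxt, ← intervalIntegral.integral_const_mul]
    refine intervalIntegral.integral_mono_on hxt
      ((hq.intervalIntegrable_one_div_averagingRadius x t).const_mul _)
      (Continuous.intervalIntegrable (continuous_const.div
        (h.isSolution_u.continuous.mul h.isSolution_v.continuous) fun ξ => (h.diag_pos ξ).ne') _ _)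
      fun ξ _ => ?_
    rw [one_div_mul_one_div]
    exact one_div_le_one_div_of_le (h.diag_pos ξ) (h.diag_le hq ξ)
  refine le_of_sq_le_sq ?_ (by positivity)
  calc green u v x t ^ 2
      = (u x * v x) * (u t * v t) * Real.exp (-∫ ξ in x..t, 1 / (u ξ * v ξ)) :=
        h.sq_green_of_le hxt
    _ ≤ (3 * averagingRadius q x) * (3 * averagingRadius q t) *
        Real.exp (-(1 / 3 * averagingDist q x t)) := by
        have := hd x
        have := hd t
        exact mul_le_mul (mul_le_mul (h.diag_le hq x) (h.diag_le hq t) (h.diag_pos t).le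
          (by positivity)) (Real.exp_le_exp.2 (neg_le_neg hdist)) (Real.exp_pos _).le
          (by positivity)
    _ = _ := by
        rw [mul_pow, mul_pow, mul_pow, Real.sq_sqrt (hd x).le, Real.sq_sqrt (hd t).le,
          ← Real.exp_nat_mul]
        push_cast
        ring_nf

end PrincipalPair

/-! ### Weights that agree with the potential -/

/-- `w` grows and decays at most subexponentially with respect to the averaging distance. -/
def Subexponential (q w : ℝ → ℝ) : Prop :=
  ∀ ε : ℝ, 0 < ε → ∃ c : ℝ, 0 < c ∧ ∀ x t, w x ≤ c * Real.exp (ε * averagingDist q x t) * w t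

section Weights

variable {q μ θ u v : ℝ → ℝ}

theorem Agrees.subexponential_left (hagree : Agrees q μ θ) (hq : IsPotential q)
    (hμ : ∀ x, 0 < μ x) : Subexponential q fun x => √(averagingRadius q x) * μ x := by
  intro ε hε
  obtain ⟨c, hc, H⟩ := hagree ε hε
  refine ⟨c, by positivity, fun x t => ?_⟩
  have := (H x t).1.2
  have ht := Real.sqrt_pos.2 (hq.averagingRadius_pos t)
  rwa [Real.sqrt_div (hq.averagingRadius_pos x).le, div_mul_div_comm,
    div_le_iff₀ (mul_pos ht (hμ t)), averagingDist_comm] at this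

theorem Agrees.subexponential_right (hagree : Agrees q μ θ) (hq : IsPotential q)
    (hθ : ∀ x, 0 < θ x) : Subexponential q fun x => √(averagingRadius q x) / θ x := by
  intro ε hε
  obtain ⟨c, hc, H⟩ := hagree ε hε
  refine ⟨c, by positivity, fun x t => ?_⟩
  have := (H x t).2.2
  have ht := Real.sqrt_pos.2 (hq.averagingRadius_pos t)
  rw [Real.sqrt_div (hq.averagingRadius_pos x).le, div_mul_div_comm, averagingDist_comm] at this
  have hx := hθ x
  have ht' := hθ t
  calc √(averagingRadius q x) / θ x
      = √(averagingRadius q x) * θ t / (√(averagingRadius q t) * θ x) *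
        (√(averagingRadius q t) / θ t) := by field_simp
    _ ≤ _ := mul_le_mul_of_nonneg_right this (by positivity)

theorem Subexponential.exists_le_mul {w : ℝ → ℝ}
    (hw : Subexponential q fun x => √(averagingRadius q x) * w x) (hw0 : ∀ x, 0 ≤ w x)
    (hq : IsPotential q) :
    ∃ C : ℝ, 0 < C ∧ ∀ x t, |t - x| ≤ averagingRadius q x / 2 → w x ≤ C * w t := by
  obtain ⟨c, hc, H⟩ := hw 1 one_pos
  refine ⟨c * Real.exp 1 * √2, by positivity, fun x t hxt => ?_⟩
  have hwt := hw0 t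
  have hdist := hq.averagingDist_le_one hxt
  have hdt := hq.averagingRadius_le_two_mul hxt
  refine le_of_mul_le_mul_left ?_ (Real.sqrt_pos.2 (hq.averagingRadius_pos x))
  calc √(averagingRadius q x) * w x
      ≤ c * Real.exp (1 * averagingDist q x t) * (√(averagingRadius q t) * w t) := H x t
    _ ≤ c * Real.exp 1 * (√(2 * averagingRadius q x) * w t) := by
        rw [one_mul]
        gcongr
    _ = √(averagingRadius q x) * (c * Real.exp 1 * √2 * w t) := by
        rw [Real.sqrt_mul zero_le_two]
        ring

theorem Subexponential.exists_mul_le {M N : ℝ → ℝ} (hM : Subexponential q M)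
    (hN : Subexponential q N) (hM0 : ∀ x, 0 ≤ M x) (hN0 : ∀ x, 0 ≤ N x) {ε : ℝ} (hε : 0 < ε) :
    ∃ c : ℝ, 0 < c ∧ ∀ x t, M x * N t ≤
      c * Real.exp (ε * averagingDist q x t) * min (M x * N x) (M t * N t) := by
  obtain ⟨c₁, hc₁, hM⟩ := hM ε hε
  obtain ⟨c₂, hc₂, hN⟩ := hN ε hε
  refine ⟨c₁ + c₂, by positivity, fun x t => ?_⟩
  set E := Real.exp (ε * averagingDist q x t) with hE_def
  have : 0 < E := Real.exp_pos _
  have hNt := hN t x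
  rw [averagingDist_comm, ← hE_def] at hNt
  have hx : M x * N t ≤ c₂ * E * (M x * N x) := by
    linarith [mul_le_mul_of_nonneg_left hNt (hM0 x)]
  have ht : M x * N t ≤ c₁ * E * (M t * N t) := by
    linarith [mul_le_mul_of_nonneg_right (hM x t) (hN0 t)]
  rw [mul_min_of_nonneg _ _ (by positivity)]
  refine le_min (hx.trans ?_) (ht.trans ?_)
  · exact mul_le_mul_of_nonneg_right (by gcongr; linarith) (mul_nonneg (hM0 x) (hN0 x))
  · exact mul_le_mul_of_nonneg_right (by gcongr; linarith) (mul_nonneg (hM0 t) (hN0 t))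

theorem Agrees.exists_kernel_le (hagree : Agrees q μ θ) (h : PrincipalPair q u v)
    (hq : IsPotential q) (hμ : ∀ x, 0 < μ x) (hθ : ∀ x, 0 < θ x) {m : ℝ}
    (hm : ∀ x, μ x / θ x * averagingRadius q x ^ 2 ≤ m) :
    ∃ C : ℝ, 0 < C ∧ ∀ x t, μ x * green u v x t / θ t ≤
      C * m * min (1 / averagingRadius q x) (1 / averagingRadius q t) *
        Real.exp (-(1 / 12) * averagingDist q x t) := by
  have hd := hq.averagingRadius_pos
  set M := fun x => √(averagingRadius q x) * μ x with hM_def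
  set N := fun x => √(averagingRadius q x) / θ x with hN_def
  obtain ⟨c, hc, hMN⟩ := (hagree.subexponential_left hq hμ).exists_mul_le
    (hagree.subexponential_right hq hθ) (fun z => mul_nonneg (Real.sqrt_nonneg _) (hμ z).le)
    (fun z => div_nonneg (Real.sqrt_nonneg _) (hθ z).le) (ε := 1 / 12) (by norm_num)
  have hdiag : ∀ z, M z * N z ≤ m * (1 / averagingRadius q z) := fun z => by
    rw [mul_one_div, le_div_iff₀ (hd z)]
    refine le_of_eq_of_le ?_ (hm z)
    have hsq := Real.mul_self_sqrt (hd z).le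
    simp only [hM_def, hN_def]
    linear_combination (μ z / θ z * averagingRadius q z) * hsq
  have hm0 : 0 ≤ m :=
    (mul_nonneg (div_nonneg (hμ 0).le (hθ 0).le) (sq_nonneg _)).trans (hm 0)
  refine ⟨3 * c, by positivity, fun x t => ?_⟩
  set D := averagingDist q x t
  have := hμ x
  have := hθ t
  calc μ x * green u v x t / θ t
      ≤ μ x * (3 * √(averagingRadius q x) * √(averagingRadius q t) *
          Real.exp (-(1 / 6) * D)) / θ t := by
        gcongr
        exact h.green_le hq x t
    _ = 3 * (M x * N t) * Real.exp (-(1 / 6) * D) := by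
        simp only [hM_def, hN_def]
        ring
    _ ≤ 3 * (c * Real.exp (1 / 12 * D) *
          min (m * (1 / averagingRadius q x)) (m * (1 / averagingRadius q t))) *
          Real.exp (-(1 / 6) * D) := by
        refine mul_le_mul_of_nonneg_right (mul_le_mul_of_nonneg_left ((hMN x t).trans ?_)
          zero_le_three) (Real.exp_pos _).le
        exact mul_le_mul_of_nonneg_left (min_le_min (hdiag x) (hdiag t)) (by positivity)
    _ = _ := by
        rw [← mul_min_of_nonneg _ _ hm0,
          show -(1 / 12) * D = 1 / 12 * D + -(1 / 6) * D by ring, Real.exp_add]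
        ring

theorem PrincipalPair.le_diag_div_green (h : PrincipalPair q u v) (hq : IsPotential q) (x t : ℝ) :
    √(averagingRadius q t) / (72 * √(averagingRadius q x)) *
      Real.exp (1 / 6 * averagingDist q x t) ≤ u t * v t / green u v x t := by
  have hx := Real.sqrt_pos.2 (hq.averagingRadius_pos x)
  have ht := Real.sqrt_pos.2 (hq.averagingRadius_pos t)
  have hsq : √(averagingRadius q t) * √(averagingRadius q t) = averagingRadius q t :=
    Real.mul_self_sqrt (hq.averagingRadius_pos t).le
  have hexp : Real.exp (1 / 6 * averagingDist q x t) *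
      Real.exp (-(1 / 6) * averagingDist q x t) = 1 := by
    rw [← Real.exp_add, ← Real.exp_zero]
    ring_nf
  rw [le_div_iff₀ (h.green_pos x t)]
  refine le_trans ((mul_le_mul_of_nonneg_left (h.green_le hq x t) (by positivity)).trans_eq ?_)
    (h.le_diag hq t)
  rw [div_mul_eq_mul_div, div_mul_eq_mul_div, div_eq_div_iff (by positivity) (by norm_num)]
  linear_combination 72 * √(averagingRadius q x) * (Real.exp (1 / 6 * averagingDist q x t) *
    Real.exp (-(1 / 6) * averagingDist q x t) * hsq + averagingRadius q t * hexp)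

namespace Subexponential

theorem tendsto_mul_green (hμ : Subexponential q fun x => √(averagingRadius q x) * μ x)
    (h : PrincipalPair q u v) (hq : IsPotential q) (hμ0 : ∀ x, 0 ≤ μ x) :
    Tendsto (fun t => μ t * green u v 0 t) (cocompact ℝ) (𝓝 0) := by
  obtain ⟨c, _, hM⟩ := hμ (1 / 12) (by norm_num)
  have hdecay : Tendsto (fun t => 3 * c * averagingRadius q 0 * μ 0 *
      Real.exp (-(1 / 12 * averagingDist q 0 t))) (cocompact ℝ) (𝓝 0) := by
    simpa using (Real.tendsto_exp_neg_atTop_nhds_zero.comp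
      (hq.tendsto_averagingDist.const_mul_atTop (by norm_num))).const_mul
        (3 * c * averagingRadius q 0 * μ 0)
  refine squeeze_zero (fun t => mul_nonneg (hμ0 t) (h.green_pos 0 t).le) (fun t => ?_) hdecay
  have hMt := hM t 0
  rw [averagingDist_comm] at hMt
  set D := averagingDist q 0 t
  set s := √(averagingRadius q 0)
  calc μ t * green u v 0 t ≤ μ t * (3 * s * √(averagingRadius q t) * Real.exp (-(1 / 6) * D)) :=
        mul_le_mul_of_nonneg_left (h.green_le hq 0 t) (hμ0 t)
    _ = 3 * s * (√(averagingRadius q t) * μ t) * Real.exp (-(1 / 6) * D) := by ring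
    _ ≤ 3 * s * (c * Real.exp (1 / 12 * D) * (s * μ 0)) * Real.exp (-(1 / 6) * D) := by gcongr
    _ = _ := by
        rw [show -(1 / 12 * D) = 1 / 12 * D + -(1 / 6) * D by ring, Real.exp_add,
          ← Real.mul_self_sqrt (hq.averagingRadius_pos 0).le]
        ring

theorem tendsto_mul_diag_div_green (hμ : Subexponential q fun x => √(averagingRadius q x) * μ x)
    (h : PrincipalPair q u v) (hq : IsPotential q) (hμ0 : ∀ x, 0 < μ x) :
    Tendsto (fun t => μ t * (u t * v t) / green u v 0 t) (cocompact ℝ) atTop := by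
  obtain ⟨c, _, hM⟩ := hμ (1 / 12) (by norm_num)
  have hgrowth : Tendsto (fun t => μ 0 / (72 * c) * Real.exp (1 / 12 * averagingDist q 0 t))
      (cocompact ℝ) atTop :=
    (Real.tendsto_exp_atTop.comp (hq.tendsto_averagingDist.const_mul_atTop
      (by norm_num))).const_mul_atTop (div_pos (hμ0 0) (by positivity))
  refine tendsto_atTop_mono (fun t => ?_) hgrowth
  have hMt := hM 0 t
  set D := averagingDist q 0 t
  have hs := Real.sqrt_pos.2 (hq.averagingRadius_pos 0)
  have hexp : Real.exp (1 / 6 * D) = Real.exp (1 / 12 * D) * Real.exp (1 / 12 * D) := by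
    rw [← Real.exp_add]
    ring_nf
  calc μ 0 / (72 * c) * Real.exp (1 / 12 * D)
      = √(averagingRadius q 0) * μ 0 *
          (Real.exp (1 / 12 * D) / (72 * c * √(averagingRadius q 0))) := by field_simp
    _ ≤ c * Real.exp (1 / 12 * D) * (√(averagingRadius q t) * μ t) *
          (Real.exp (1 / 12 * D) / (72 * c * √(averagingRadius q 0))) := by gcongr
    _ = μ t * (√(averagingRadius q t) / (72 * √(averagingRadius q 0)) *
          Real.exp (1 / 6 * D)) := by
        rw [hexp]
        field_simp
    _ ≤ μ t * (u t * v t / green u v 0 t) :=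
        mul_le_mul_of_nonneg_left (h.le_diag_div_green hq 0 t) (hμ0 t).le
    _ = μ t * (u t * v t) / green u v 0 t := (mul_div_assoc _ _ _).symm

theorem tendsto_mul_u_atTop (hμ : Subexponential q fun x => √(averagingRadius q x) * μ x)
    (h : PrincipalPair q u v) (hq : IsPotential q) (hμ0 : ∀ x, 0 ≤ μ x) :
    Tendsto (fun t => μ t * u t) atTop (𝓝 0) := by
  have := ((hμ.tendsto_mul_green h hq hμ0).mono_left atTop_le_cocompact).div_const (v 0)
  rw [zero_div] at this
  refine this.congr' ?_
  filter_upwards [eventually_ge_atTop 0] with t ht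
  rw [green_of_le ht, ← mul_assoc, mul_div_cancel_right₀ _ (h.v_pos 0).ne']

theorem tendsto_mul_v_atBot (hμ : Subexponential q fun x => √(averagingRadius q x) * μ x)
    (h : PrincipalPair q u v) (hq : IsPotential q) (hμ0 : ∀ x, 0 ≤ μ x) :
    Tendsto (fun t => μ t * v t) atBot (𝓝 0) := by
  have := ((hμ.tendsto_mul_green h hq hμ0).mono_left atBot_le_cocompact).div_const (u 0)
  rw [zero_div] at this
  refine this.congr' ?_
  filter_upwards [eventually_le_atBot 0] with t ht
  have := (h.u_pos 0).ne'
  rw [green_of_ge ht]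
  field_simp

theorem tendsto_mul_v_atTop (hμ : Subexponential q fun x => √(averagingRadius q x) * μ x)
    (h : PrincipalPair q u v) (hq : IsPotential q) (hμ0 : ∀ x, 0 < μ x) :
    Tendsto (fun t => μ t * v t) atTop atTop := by
  refine (((hμ.tendsto_mul_diag_div_green h hq hμ0).mono_left atTop_le_cocompact).atTop_mul_const
    (h.v_pos 0)).congr' ?_
  filter_upwards [eventually_ge_atTop 0] with t ht
  have := (h.v_pos 0).ne'
  have := (h.u_pos t).ne'
  rw [green_of_le ht]
  field_simp

theorem tendsto_mul_u_atBot (hμ : Subexponential q fun x => √(averagingRadius q x) * μ x)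
    (h : PrincipalPair q u v) (hq : IsPotential q) (hμ0 : ∀ x, 0 < μ x) :
    Tendsto (fun t => μ t * u t) atBot atTop := by
  refine (((hμ.tendsto_mul_diag_div_green h hq hμ0).mono_left atBot_le_cocompact).atTop_mul_const
    (h.u_pos 0)).congr' ?_
  filter_upwards [eventually_le_atBot 0] with t ht
  have := (h.u_pos 0).ne'
  have := (h.v_pos t).ne'
  rw [green_of_ge ht]
  field_simp

end Subexponential

end Weights

/-! ### The Schur test -/

section Schur

variable {α β : Type*} [MeasurableSpace α] [MeasurableSpace β] {μ : Measure α} {ν : Measure β}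

theorem lintegral_mul_rpow_le {k g : α → ℝ≥0∞} (hk : AEMeasurable k μ) (hg : AEMeasurable g μ)
    {r : ℝ} (hr : 1 ≤ r) :
    (∫⁻ t, k t * g t ∂μ) ^ r ≤ (∫⁻ t, k t ∂μ) ^ (r - 1) * ∫⁻ t, k t * g t ^ r ∂μ := by
  have hr0 : 0 < r := by linarith
  have hr1 : 0 ≤ 1 - 1 / r := sub_nonneg.2 ((div_le_one hr0).2 hr)
  have hsplit : ∀ t, k t ^ (1 - 1 / r) * (k t * g t ^ r) ^ (1 / r) = k t * g t := fun t => by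
    rw [ENNReal.mul_rpow_of_nonneg _ _ (by positivity), ← ENNReal.rpow_mul,
      mul_one_div_cancel hr0.ne', ENNReal.rpow_one, ← mul_assoc,
      ← ENNReal.rpow_add_of_nonneg _ _ hr1 (by positivity), sub_add_cancel, ENNReal.rpow_one]
  have holder := ENNReal.lintegral_mul_norm_pow_le hk (hk.mul (hg.pow_const r)) hr1
    (by positivity : 0 ≤ 1 / r) (by ring)
  simp only [Pi.mul_apply, hsplit] at holder
  refine (ENNReal.rpow_le_rpow holder hr0.le).trans_eq ?_
  rw [ENNReal.mul_rpow_of_nonneg _ _ hr0.le, ← ENNReal.rpow_mul, ← ENNReal.rpow_mul,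
    one_div_mul_cancel hr0.ne', ENNReal.rpow_one, sub_mul, one_div_mul_cancel hr0.ne', one_mul]

variable [SFinite μ] [SFinite ν] {k : α → β → ℝ≥0∞} {g : β → ℝ≥0∞} {A : ℝ≥0∞}

theorem lintegral_rpow_lintegral_mul_le (hk : Measurable (Function.uncurry k))
    (hg : AEMeasurable g ν) (hrow : ∀ x, ∫⁻ t, k x t ∂ν ≤ A) (hcol : ∀ t, ∫⁻ x, k x t ∂μ ≤ A)
    {r : ℝ} (hr : 1 ≤ r) :
    ∫⁻ x, (∫⁻ t, k x t * g t ∂ν) ^ r ∂μ ≤ A ^ r * ∫⁻ t, g t ^ r ∂ν := by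
  have hkx : ∀ x, Measurable (k x) := fun x => hk.comp measurable_prodMk_left
  have hkt : ∀ t, Measurable fun x => k x t := fun t => hk.comp measurable_prodMk_right
  have hprod : AEMeasurable (Function.uncurry fun x t => k x t * g t ^ r) (μ.prod ν) :=
    hk.aemeasurable.mul (hg.pow_const r).comp_snd
  have hinner : AEMeasurable (fun x => ∫⁻ t, k x t * g t ^ r ∂ν) μ := hprod.lintegral_prod_right'
  calc ∫⁻ x, (∫⁻ t, k x t * g t ∂ν) ^ r ∂μ
      ≤ ∫⁻ x, A ^ (r - 1) * ∫⁻ t, k x t * g t ^ r ∂ν ∂μ := lintegral_mono fun x =>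
        (lintegral_mul_rpow_le (hkx x).aemeasurable hg hr).trans <| mul_le_mul_left
          (ENNReal.rpow_le_rpow (hrow x) (sub_nonneg.2 hr)) _
    _ = A ^ (r - 1) * ∫⁻ t, (∫⁻ x, k x t ∂μ) * g t ^ r ∂ν := by
        rw [lintegral_const_mul'' _ hinner, lintegral_lintegral_swap hprod]
        simp only [lintegral_mul_const _ (hkt _)]
    _ ≤ A ^ (r - 1) * ∫⁻ t, A * g t ^ r ∂ν := by gcongr with t; exact hcol t
    _ = A ^ r * ∫⁻ t, g t ^ r ∂ν := by
        rw [lintegral_const_mul'' _ (hg.pow_const r), ← mul_assoc]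
        congr 1
        nth_rewrite 2 [← ENNReal.rpow_one A]
        rw [← ENNReal.rpow_add_of_nonneg _ _ (sub_nonneg.2 hr) zero_le_one, sub_add_cancel]

theorem eLpNorm_lintegral_mul_le (hk : Measurable (Function.uncurry k)) (hg : AEMeasurable g ν)
    (hrow : ∀ x, ∫⁻ t, k x t ∂ν ≤ A) (hcol : ∀ t, ∫⁻ x, k x t ∂μ ≤ A) {p : ℝ≥0∞} (hp : 1 ≤ p) :
    eLpNorm (fun x => ∫⁻ t, k x t * g t ∂ν) p μ ≤ A * eLpNorm g p ν := by
  rcases eq_or_ne p ∞ with rfl | hp_top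
  · rw [eLpNorm_exponent_top, eLpNorm_exponent_top]
    refine essSup_le_of_ae_le _ (Eventually.of_forall fun x => ?_)
    calc ∫⁻ t, k x t * g t ∂ν ≤ ∫⁻ t, k x t * eLpNormEssSup g ν ∂ν :=
          lintegral_mono_ae ((enorm_ae_le_eLpNormEssSup g ν).mono fun t ht => by gcongr; exact ht)
      _ = (∫⁻ t, k x t ∂ν) * eLpNormEssSup g ν :=
          lintegral_mul_const _ (hk.comp measurable_prodMk_left)
      _ ≤ A * eLpNormEssSup g ν := by gcongr; exact hrow x
  · have hp0 : p ≠ 0 := (one_pos.trans_le hp).ne'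
    have hr : 1 ≤ p.toReal := by simpa using ENNReal.toReal_mono hp_top hp
    have hr0 : 0 < p.toReal := by linarith
    rw [eLpNorm_eq_lintegral_rpow_enorm_toReal hp0 hp_top,
      eLpNorm_eq_lintegral_rpow_enorm_toReal hp0 hp_top]
    refine (ENNReal.rpow_le_rpow (lintegral_rpow_lintegral_mul_le hk hg hrow hcol hr)
      (by positivity)).trans_eq ?_
    rw [ENNReal.mul_rpow_of_nonneg _ _ (by positivity), ← ENNReal.rpow_mul,
      mul_one_div_cancel hr0.ne', ENNReal.rpow_one]
    rfl

end Schur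

theorem integrable_exp_neg_mul_abs {β : ℝ} (hβ : 0 < β) :
    Integrable fun z : ℝ => Real.exp (-β * |z|) := by
  rw [← integrableOn_univ, ← Iic_union_Ioi (a := (0 : ℝ))]
  refine IntegrableOn.union ?_ ?_
  · refine (integrableOn_exp_mul_Iic hβ 0).congr_fun (fun z hz => ?_) measurableSet_Iic
    simp only [abs_of_nonpos (mem_Iic.1 hz), neg_mul_neg]
  · refine (exp_neg_integrableOn_Ioi 0 hβ).congr_fun (fun z hz => ?_) measurableSet_Ioi
    simp only [abs_of_pos (mem_Ioi.1 hz)]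

theorem IsPotential.lintegral_exp_averagingDist_le {q : ℝ → ℝ} (hq : IsPotential q) (β x : ℝ) :
    ∫⁻ t, ENNReal.ofReal (1 / averagingRadius q t * Real.exp (-β * averagingDist q x t)) ≤
      ∫⁻ z, ENNReal.ofReal (Real.exp (-β * |z|)) := by
  have hinv_pos := fun t => one_div_pos.2 (hq.averagingRadius_pos t)
  have hcont : Continuous fun ξ => 1 / averagingRadius q ξ :=
    continuous_const.div hq.continuous_averagingRadius fun ξ => (hq.averagingRadius_pos ξ).ne'
  set R : ℝ → ℝ := fun t => ∫ ξ in x..t, 1 / averagingRadius q ξ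
  have hR : ∀ t, HasDerivAt R (1 / averagingRadius q t) t := fun t =>
    (hcont.integral_hasStrictDerivAt x t).hasDerivAt
  have hR_mono : StrictMono R := strictMono_of_deriv_pos fun t => (hR t).deriv ▸ hinv_pos t
  calc ∫⁻ t, ENNReal.ofReal (1 / averagingRadius q t * Real.exp (-β * averagingDist q x t))
      = ∫⁻ t in univ, ENNReal.ofReal |1 / averagingRadius q t| *
          ENNReal.ofReal (Real.exp (-β * |R t|)) := by
        rw [Measure.restrict_univ]
        refine lintegral_congr fun t => ?_
        rw [ENNReal.ofReal_mul (hinv_pos t).le, abs_of_pos (hinv_pos t)]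
        rfl
    _ = ∫⁻ z in R '' univ, ENNReal.ofReal (Real.exp (-β * |z|)) :=
        (lintegral_image_eq_lintegral_abs_deriv_mul MeasurableSet.univ
          (fun t _ => (hR t).hasDerivWithinAt) hR_mono.injective.injOn
          fun z => ENNReal.ofReal (Real.exp (-β * |z|))).symm
    _ ≤ ∫⁻ z, ENNReal.ofReal (Real.exp (-β * |z|)) := setLIntegral_le_lintegral _ _

/-! ### The Green operator -/

/-- The integral operator whose kernel is the Green function of `-d²/dx² + q`; where it converges
it gives a solution of `-y'' + q y = f`. -/
noncomputable def greenOp (u v f : ℝ → ℝ) (x : ℝ) : ℝ :=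
  ∫ t, green u v x t * f t

namespace PrincipalPair

variable {q u v f : ℝ → ℝ} {x : ℝ}

theorem continuous_green (h : PrincipalPair q u v) : Continuous (Function.uncurry (green u v)) :=
  (h.isSolution_u.continuous.comp (continuous_fst.max continuous_snd)).mul
    (h.isSolution_v.continuous.comp (continuous_fst.min continuous_snd))

theorem green_eq_min (h : PrincipalPair q u v) (x t : ℝ) :
    green u v x t = min (u x * v t) (u t * v x) := by
  rcases le_total x t with hxt | hxt
  · rw [green_of_le hxt, min_eq_right]
    exact mul_le_mul (h.antitone_u hxt) (h.monotone_v hxt) (h.v_pos x).le (h.u_pos x).le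
  · rw [green_of_ge hxt, min_eq_left]
    exact mul_le_mul (h.antitone_u hxt) (h.monotone_v hxt) (h.v_pos t).le (h.u_pos t).le

theorem green_le_mul_green (h : PrincipalPair q u v) (x y t : ℝ) :
    green u v x t ≤ max (u x / u y) (v x / v y) * green u v y t := by
  have hu := h.u_pos
  have hv := h.v_pos
  have hu_ratio : u x / u y * (u y * v t) = u x * v t := by field_simp [(hu y).ne']
  have hv_ratio : v x / v y * (u t * v y) = u t * v x := by field_simp [(hv y).ne']
  rcases min_choice (u y * v t) (u t * v y) with hmin | hmin <;> rw [h.green_eq_min y, hmin]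
  · calc green u v x t ≤ u x * v t := h.green_eq_min x t ▸ min_le_left _ _
      _ = u x / u y * (u y * v t) := hu_ratio.symm
      _ ≤ _ := mul_le_mul_of_nonneg_right (le_max_left _ _) (mul_pos (hu y) (hv t)).le
  · calc green u v x t ≤ u t * v x := h.green_eq_min x t ▸ min_le_right _ _
      _ = v x / v y * (u t * v y) := hv_ratio.symm
      _ ≤ _ := mul_le_mul_of_nonneg_right (le_max_right _ _) (mul_pos (hu t) (hv y)).le

theorem aestronglyMeasurable_green_mul (h : PrincipalPair q u v)
    (hf : AEStronglyMeasurable f volume) (x : ℝ) :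
    AEStronglyMeasurable (fun t => green u v x t * f t) volume :=
  (h.continuous_green.comp (Continuous.prodMk_right x)).aestronglyMeasurable.mul hf

theorem integrable_green_mul (h : PrincipalPair q u v) (hf : AEStronglyMeasurable f volume) {y : ℝ}
    (hy : Integrable fun t => green u v y t * f t) (x : ℝ) :
    Integrable fun t => green u v x t * f t := by
  refine (hy.const_mul (max (u x / u y) (v x / v y))).mono (h.aestronglyMeasurable_green_mul hf x)
    (ae_of_all _ fun t => ?_)
  have hle := h.green_le_mul_green x y t
  have hpos := (h.green_pos x t).le
  rw [← mul_assoc, norm_mul, norm_mul, Real.norm_of_nonneg hpos,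
    Real.norm_of_nonneg (hpos.trans hle)]
  exact mul_le_mul_of_nonneg_right hle (norm_nonneg _)

theorem integrableOn_v_mul (h : PrincipalPair q u v)
    (hx : Integrable fun t => green u v x t * f t) : IntegrableOn (fun t => v t * f t) (Iic x) := by
  refine ((hx.const_mul (u x)⁻¹).integrableOn).congr_fun (fun t ht => ?_) measurableSet_Iic
  simp only [green_of_ge (mem_Iic.1 ht)]
  field_simp [(h.u_pos x).ne']

theorem integrableOn_u_mul (h : PrincipalPair q u v)
    (hx : Integrable fun t => green u v x t * f t) : IntegrableOn (fun t => u t * f t) (Ioi x) := by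
  refine ((hx.const_mul (v x)⁻¹).integrableOn).congr_fun (fun t ht => ?_) measurableSet_Ioi
  simp only [green_of_le (mem_Ioi.1 ht).le]
  field_simp [(h.v_pos x).ne']

end PrincipalPair

theorem greenOp_eq {u v f : ℝ → ℝ} {x : ℝ} (hx : Integrable fun t => green u v x t * f t) :
    greenOp u v f x = u x * (∫ t in Iic x, v t * f t) + v x * ∫ t in Ioi x, u t * f t := by
  rw [greenOp, ← intervalIntegral.integral_Iic_add_Ioi (b := x) hx.integrableOn hx.integrableOn,
    ← integral_const_mul, ← integral_const_mul]
  congr 1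
  · refine setIntegral_congr_fun measurableSet_Iic fun t ht => ?_
    simp only [green_of_ge (mem_Iic.1 ht), mul_assoc]
  · refine setIntegral_congr_fun measurableSet_Ioi fun t ht => ?_
    simp only [green_of_le (mem_Ioi.1 ht).le]
    ring

namespace PrincipalPair

variable {q u v f : ℝ → ℝ}

theorem variation_of_parameters (h : PrincipalPair q u v) {A B : ℝ → ℝ} (hA : LocallyAC A)
    (hB : LocallyAC B) (hA' : ∀ᵐ x, HasDerivAt A (v x * f x) x)
    (hB' : ∀ᵐ x, HasDerivAt B (-(u x * f x)) x) : IsSolution q f (u * A + v * B) := by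
  have hu := h.isSolution_u
  have hv := h.isSolution_v
  have hg : LocallyAC (deriv u * A + deriv v * B) :=
    (hu.locallyAC_deriv.mul hA).add (hv.locallyAC_deriv.mul hB)
  refine .of_hasDerivAt (LocallyAC.hasDerivAt_of_continuous
    ((hu.locallyAC.mul hA).add (hv.locallyAC.mul hB)) ?_ hg.continuous) hg ?_
  · filter_upwards [hA', hB'] with x hAx hBx
    convert! ((hu.hasDerivAt x).mul hAx).add ((hv.hasDerivAt x).mul hBx) using 1
    simp only [Pi.add_apply, Pi.mul_apply]
    ring
  · filter_upwards [hA', hB', hu.ae_hasDerivAt_deriv, hv.ae_hasDerivAt_deriv] with x hAx hBx hux hvx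
    convert! (hux.mul hAx).add (hvx.mul hBx) using 1
    simp only [Pi.add_apply, Pi.mul_apply, Pi.zero_apply]
    linear_combination f x * h.wronskian x

theorem isSolution_greenOp (h : PrincipalPair q u v) (hf : LocallyIntegrable f volume)
    (hi : ∀ x, Integrable fun t => green u v x t * f t) : IsSolution q f (greenOp u v f) := by
  have hvf : LocallyIntegrable (fun t => v t * f t) volume := by
    simpa only [smul_eq_mul, mul_comm] using hf.smul_continuous h.isSolution_v.continuous
  have huf : LocallyIntegrable (fun t => -(u t * f t)) volume := by
    simpa only [smul_eq_mul, mul_comm] using! (hf.smul_continuous h.isSolution_u.continuous).neg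
  set A : ℝ → ℝ := fun x => ∫ t in Iic x, v t * f t
  set B : ℝ → ℝ := fun x => ∫ t in Ioi x, u t * f t
  have hA : ∀ x, A x = A 0 + ∫ t in (0 : ℝ)..x, v t * f t := fun x =>
    (eq_add_of_sub_eq' (intervalIntegral.integral_Iic_sub_Iic (h.integrableOn_v_mul (hi 0))
      (h.integrableOn_v_mul (hi x))))
  have hB : ∀ x, B x = B 0 + ∫ t in (0 : ℝ)..x, -(u t * f t) := fun x => by
    rw [intervalIntegral.integral_neg, ← intervalIntegral.integral_Ioi_sub_Ioi'
      (h.integrableOn_u_mul (hi 0)) (h.integrableOn_u_mul (hi x)), neg_sub, add_sub_cancel]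
  have hA_ac := LocallyAC.of_eq_add_integral (intervalIntegrable_of_locallyIntegrable hvf) hA
  have hB_ac := LocallyAC.of_eq_add_integral (intervalIntegrable_of_locallyIntegrable huf) hB
  rw [show greenOp u v f = u * A + v * B from funext fun x => greenOp_eq (hi x)]
  refine h.variation_of_parameters hA_ac hB_ac ?_ ?_
  · filter_upwards [_root_.LocallyIntegrable.ae_hasDerivAt_integral hvf] with x hx
    exact funext hA ▸ (hx 0).const_add _
  · filter_upwards [_root_.LocallyIntegrable.ae_hasDerivAt_integral huf] with x hx
    exact funext hB ▸ (hx 0).const_add _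

theorem exists_eq_comb (h : PrincipalPair q u v) {y : ℝ → ℝ} (hy : IsSolution q 0 y) :
    ∃ a b : ℝ, ∀ x, y x = a * u x + b * v x := by
  refine ⟨-(deriv y 0 * v 0 - y 0 * deriv v 0), deriv y 0 * u 0 - y 0 * deriv u 0, fun x => ?_⟩
  rw [hy.wronskian_eq h.isSolution_v 0 x, hy.wronskian_eq h.isSolution_u 0 x]
  linear_combination -y x * h.wronskian x

end PrincipalPair

/-! ### Weighted bounds for the Green operator -/

theorem MemLpLoc.locallyIntegrable {f : ℝ → ℝ} {p : ℝ≥0∞} (hf : MemLpLoc f p) (hp : 1 ≤ p) :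
    LocallyIntegrable f volume := by
  refine locallyIntegrable_iff.2 fun K hK => ?_
  have : IsFiniteMeasure (volume.restrict K) := ⟨by simpa using hK.measure_lt_top⟩
  exact (hf.2 K hK).integrable hp

theorem MemLpLoc.of_continuous {f : ℝ → ℝ} (hf : Continuous f) (p : ℝ≥0∞) : MemLpLoc f p := by
  refine ⟨hf.aestronglyMeasurable, fun K hK => ?_⟩
  have : IsFiniteMeasure (volume.restrict K) := ⟨by simpa using hK.measure_lt_top⟩
  obtain ⟨C, hC⟩ := hK.exists_bound_of_continuousOn hf.continuousOn
  exact MemLp.of_bound hf.aestronglyMeasurable C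
    ((ae_restrict_iff' hK.measurableSet).2 (ae_of_all _ hC))

theorem exists_lt_top_of_eLpNorm_lt_top {α : Type*} [MeasurableSpace α] {ν : Measure α} [NeZero ν]
    {F : α → ℝ≥0∞} {p : ℝ≥0∞} (hp : p ≠ 0) (hF : eLpNorm F p ν < ∞) : ∃ x, F x < ∞ := by
  by_contra! hinf
  have hconst : F = fun _ => ∞ := funext fun x => top_le_iff.1 (hinf x)
  have huniv : ν univ ^ (1 / p.toReal) ≠ 0 := by
    simp [ENNReal.rpow_eq_zero_iff, NeZero.ne ν]
  rw [hconst, eLpNorm_const _ hp (NeZero.ne ν), enorm_eq_self, ENNReal.top_mul huniv] at hF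
  exact hF.ne rfl

section GreenBounds

variable {q μ θ u v f : ℝ → ℝ} {A p : ℝ≥0∞}

theorem Agrees.exists_lintegral_kernel_le (hagree : Agrees q μ θ) (h : PrincipalPair q u v)
    (hq : IsPotential q) (hμ : ∀ x, 0 < μ x) (hθ : ∀ x, 0 < θ x) (hm : weightSup q μ θ < ∞) :
    ∃ A : ℝ≥0∞, A < ∞ ∧ (∀ x, ∫⁻ t, ENNReal.ofReal (μ x * green u v x t / θ t) ≤ A) ∧
      ∀ t, ∫⁻ x, ENNReal.ofReal (μ x * green u v x t / θ t) ≤ A := by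
  have hm' : ∀ x, μ x / θ x * averagingRadius q x ^ 2 ≤ (weightSup q μ θ).toReal := fun x =>
    (ENNReal.ofReal_le_iff_le_toReal hm.ne).1 <|
      le_iSup (fun x => ENNReal.ofReal (μ x / θ x * averagingRadius q x ^ 2)) x
  obtain ⟨C, hC, hker⟩ := hagree.exists_kernel_le h hq hμ hθ hm'
  set K := C * (weightSup q μ θ).toReal
  have hK : 0 ≤ K := by positivity
  set J := ∫⁻ z, ENNReal.ofReal (Real.exp (-(1 / 12) * |z|))
  have hJ : J < ∞ := (integrable_exp_neg_mul_abs (by norm_num)).lintegral_lt_top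
  have hle : ∀ {F : ℝ → ℝ} (x : ℝ), (∀ t, F t ≤ K * (1 / averagingRadius q t) *
      Real.exp (-(1 / 12) * averagingDist q x t)) →
      ∫⁻ t, ENNReal.ofReal (F t) ≤ ENNReal.ofReal K * J := fun {F} x hF =>
    calc ∫⁻ t, ENNReal.ofReal (F t) ≤ ∫⁻ t, ENNReal.ofReal K * ENNReal.ofReal
          (1 / averagingRadius q t * Real.exp (-(1 / 12) * averagingDist q x t)) :=
          lintegral_mono fun t => by
            rw [← ENNReal.ofReal_mul hK, ← mul_assoc]
            exact ENNReal.ofReal_le_ofReal (hF t)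
      _ ≤ ENNReal.ofReal K * J := by
        rw [lintegral_const_mul' _ _ ENNReal.ofReal_ne_top]
        gcongr
        exact hq.lintegral_exp_averagingDist_le _ x
  refine ⟨ENNReal.ofReal K * J, ENNReal.mul_lt_top ENNReal.ofReal_lt_top hJ,
    fun x => hle x fun t => (hker x t).trans ?_, fun t => hle t fun x => (hker x t).trans ?_⟩
  · gcongr
    exact min_le_right _ _
  · rw [averagingDist_comm q t x]
    gcongr
    exact min_le_left _ _

theorem PrincipalPair.eLpNorm_lintegral_green_mul_le (h : PrincipalPair q u v) (hμ : Measurable μ)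
    (hμ_nonneg : ∀ x, 0 ≤ μ x) (hθ : Measurable θ) (hθ_pos : ∀ x, 0 < θ x)
    (hrow : ∀ x, ∫⁻ t, ENNReal.ofReal (μ x * green u v x t / θ t) ≤ A)
    (hcol : ∀ t, ∫⁻ x, ENNReal.ofReal (μ x * green u v x t / θ t) ≤ A) (hp : 1 ≤ p)
    (hf : AEStronglyMeasurable f volume) :
    eLpNorm (fun x => ‖μ x‖ₑ * ∫⁻ t, ‖green u v x t * f t‖ₑ) p volume ≤
      A * weightedNorm θ p f := by
  have hk : Measurable (Function.uncurry fun x t => ENNReal.ofReal (μ x * green u v x t / θ t)) :=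
    ENNReal.measurable_ofReal.comp
      (((hμ.comp measurable_fst).mul h.continuous_green.measurable).div (hθ.comp measurable_snd))
  have hθf : AEStronglyMeasurable (fun t => θ t * f t) volume := hθ.aestronglyMeasurable.mul hf
  have hsplit : ∀ x t, ‖μ x‖ₑ * ‖green u v x t * f t‖ₑ =
      ENNReal.ofReal (μ x * green u v x t / θ t) * ‖θ t * f t‖ₑ := fun x t => by
    have := h.green_pos x t
    have := hθ_pos t
    have := hμ_nonneg x
    rw [← Real.enorm_of_nonneg (by positivity), ← enorm_mul, ← enorm_mul]
    congr 1
    field_simp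
  simp only [← lintegral_const_mul' _ _ enorm_ne_top, hsplit]
  rw [weightedNorm, ← eLpNorm_enorm fun t => θ t * f t]
  exact eLpNorm_lintegral_mul_le hk hθf.enorm hrow hcol hp

theorem PrincipalPair.exists_weightedNorm_greenOp_le (h : PrincipalPair q u v) (hq : IsPotential q)
    (hμ : Measurable μ) (hμ_pos : ∀ x, 0 < μ x) (hθ : Measurable θ) (hθ_pos : ∀ x, 0 < θ x)
    (hagree : Agrees q μ θ) (hm : weightSup q μ θ < ∞) (hp : 1 ≤ p) :
    ∃ A : ℝ≥0∞, A < ∞ ∧ ∀ f, AEStronglyMeasurable f volume →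
      weightedNorm μ p (greenOp u v f) ≤ A * weightedNorm θ p f ∧
      (weightedNorm θ p f < ∞ → ∀ x, Integrable fun t => green u v x t * f t) := by
  obtain ⟨A, hA, hrow, hcol⟩ := hagree.exists_lintegral_kernel_le h hq hμ_pos hθ_pos hm
  refine ⟨A, hA, fun f hf => ?_⟩
  have hbound := h.eLpNorm_lintegral_green_mul_le hμ (fun x => (hμ_pos x).le) hθ hθ_pos hrow hcol
    hp hf
  refine ⟨(eLpNorm_mono_enorm fun x => ?_).trans hbound, fun hfin => ?_⟩
  · rw [enorm_mul, enorm_eq_self]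
    gcongr
    exact enorm_integral_le_lintegral_enorm _
  · obtain ⟨x₀, hx₀⟩ := exists_lt_top_of_eLpNorm_lt_top (one_pos.trans_le hp).ne'
      (hbound.trans_lt (ENNReal.mul_lt_top hA hfin))
    have hμ₀ : ‖μ x₀‖ₑ ≠ 0 := enorm_ne_zero.2 (hμ_pos x₀).ne'
    exact h.integrable_green_mul hf
      ⟨h.aestronglyMeasurable_green_mul hf x₀, ENNReal.lt_top_of_mul_ne_top_right hx₀.ne hμ₀⟩

end GreenBounds

/-! ### Uniqueness -/

theorem eLpNorm_eq_top_of_tendsto_norm {α E : Type*} [MeasurableSpace α] [NormedAddCommGroup E]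
    {ν : Measure α} {F : α → E} {l : Filter α} {p : ℝ≥0∞} (hp : p ≠ 0)
    (hl : ∀ s ∈ l, ν s = ∞) (hF : StronglyMeasurable F)
    (hlim : Tendsto (fun x => ‖F x‖) l atTop) : eLpNorm F p ν = ∞ := by
  refine ENNReal.eq_top_of_forall_nnreal_le fun n => ?_
  set S := {x | (n : ℝ) ≤ ‖F x‖}
  have hS : ν S = ∞ := hl S (hlim.eventually_ge_atTop (n : ℝ))
  have hS_meas : MeasurableSet S := measurableSet_le measurable_const hF.norm.measurable
  calc (n : ℝ≥0∞) = n * 1 ^ (1 / p.toReal) := by rw [ENNReal.one_rpow, mul_one]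
    _ ≤ n * ν S ^ (1 / p.toReal) := by
        gcongr
        exact hS ▸ le_top
    _ = eLpNorm (S.indicator fun _ => (n : ℝ)) p ν := by
        rw [eLpNorm_indicator_const' hS_meas (by simp [hS]) hp]
        simp
    _ ≤ eLpNorm F p ν := eLpNorm_mono fun x => by
        by_cases hx : x ∈ S
        · rw [indicator_of_mem hx, NNReal.norm_eq]
          exact hx
        · rw [indicator_of_notMem hx, norm_zero]
          exact norm_nonneg _

theorem volume_eq_top_of_mem_atTop {s : Set ℝ} (hs : s ∈ atTop) : volume s = ∞ := by
  obtain ⟨a, ha⟩ := mem_atTop_sets.1 hs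
  exact top_le_iff.1 (Real.volume_Ici (a := a) ▸ measure_mono ha)

theorem volume_eq_top_of_mem_atBot {s : Set ℝ} (hs : s ∈ atBot) : volume s = ∞ := by
  obtain ⟨a, ha⟩ := mem_atBot_sets.1 hs
  exact top_le_iff.1 (Real.volume_Iic (a := a) ▸ measure_mono ha)

theorem coeff_eq_zero_of_weightedNorm_lt_top {w y U V : ℝ → ℝ} {l : Filter ℝ} {a b : ℝ}
    {p : ℝ≥0∞} (hp : p ≠ 0) (hl : ∀ s ∈ l, volume s = ∞) (hw : Measurable w) (hy : Continuous y)
    (hfin : weightedNorm w p y < ∞) (hU : Tendsto (fun t => w t * U t) l (𝓝 0))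
    (hV : Tendsto (fun t => w t * V t) l atTop) (hyUV : ∀ᶠ t in l, y t = a * U t + b * V t) :
    b = 0 := by
  by_contra hb
  have hlim : Tendsto (fun t => b⁻¹ • (w t * y t)) l atTop := by
    refine ((hU.const_mul (b⁻¹ * a)).add_atTop hV).congr' (hyUV.mono fun t ht => ?_)
    simp only [ht, smul_eq_mul]
    field_simp
  have hmeas : StronglyMeasurable (b⁻¹ • fun t => w t * y t) :=
    (hw.mul hy.measurable).stronglyMeasurable.const_smul _
  have htop := eLpNorm_eq_top_of_tendsto_norm hp hl hmeas (tendsto_norm_atTop_atTop.comp hlim)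
  rw [eLpNorm_const_smul] at htop
  exact (ENNReal.mul_lt_top enorm_lt_top hfin).ne htop

namespace PrincipalPair

variable {q μ u v f y z : ℝ → ℝ} {a b : ℝ} {p : ℝ≥0∞}

theorem eq_of_weightedNorm_lt_top (h : PrincipalPair q u v) (hq : IsPotential q) (hp : p ≠ 0)
    (hμ : Measurable μ) (hμ_pos : ∀ x, 0 < μ x)
    (hμ_sub : Subexponential q fun x => √(averagingRadius q x) * μ x)
    (hy : IsSolution q f y) (hz : IsSolution q f z) (hfin : weightedNorm μ p y < ∞)
    (hz_top : ∀ᶠ t in atTop, z t = a * u t) (hz_bot : ∀ᶠ t in atBot, z t = b * v t) : y = z := by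
  have hμ0 : ∀ x, 0 ≤ μ x := fun x => (hμ_pos x).le
  obtain ⟨α, β, hαβ⟩ := h.exists_eq_comb (sub_self f ▸ hy.sub hz)
  have hβ : β = 0 := coeff_eq_zero_of_weightedNorm_lt_top (a := α + a) hp
    (fun _ => volume_eq_top_of_mem_atTop) hμ hy.continuous hfin
    (hμ_sub.tendsto_mul_u_atTop h hq hμ0)
    (hμ_sub.tendsto_mul_v_atTop h hq hμ_pos) <| hz_top.mono fun t ht => by
      have := hαβ t
      rw [Pi.sub_apply, ht] at this
      linarith
  have hα : α = 0 := coeff_eq_zero_of_weightedNorm_lt_top (a := β + b) hp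
    (fun _ => volume_eq_top_of_mem_atBot) hμ hy.continuous hfin
    (hμ_sub.tendsto_mul_v_atBot h hq hμ0)
    (hμ_sub.tendsto_mul_u_atBot h hq hμ_pos) <| hz_bot.mono fun t ht => by
      have := hαβ t
      rw [Pi.sub_apply, ht] at this
      linarith
  funext x
  have := hαβ x
  rw [hα, hβ, Pi.sub_apply] at this
  linarith

theorem solution_unique (h : PrincipalPair q u v) (hq : IsPotential q) (hp : 1 ≤ p)
    (hμ : Measurable μ) (hμ_pos : ∀ x, 0 < μ x)
    (hμ_sub : Subexponential q fun x => √(averagingRadius q x) * μ x)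
    (hy : IsSolution q f y) (hz : IsSolution q f z) (hy_fin : weightedNorm μ p y < ∞)
    (hz_fin : weightedNorm μ p z < ∞) : y = z := by
  have hdiff : IsSolution q 0 (y - z) := sub_self f ▸ hy.sub hz
  have hzero : IsSolution q 0 0 := by simpa using hdiff.const_smul 0
  have hfin : weightedNorm μ p (y - z) < ∞ := by
    refine lt_of_eq_of_lt (congrArg (eLpNorm · p volume) ?_) ((eLpNorm_sub_le
      (hμ.mul hy.continuous.measurable).aestronglyMeasurable
      (hμ.mul hz.continuous.measurable).aestronglyMeasurable hp).trans_lt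
      (ENNReal.add_lt_top.2 ⟨hy_fin, hz_fin⟩))
    funext x
    exact mul_sub _ _ _
  refine sub_eq_zero.1 (h.eq_of_weightedNorm_lt_top (a := 0) (b := 0) hq
    (one_pos.trans_le hp).ne' hμ hμ_pos hμ_sub hdiff hzero hfin ?_ ?_) <;>
  exact Eventually.of_forall fun t => by simp

end PrincipalPair

/-! ### Sufficiency -/

theorem PrincipalPair.isAdmissible {q μ θ u v : ℝ → ℝ} {p : ℝ≥0∞} (h : PrincipalPair q u v)
    (hq : IsPotential q) (hμ : Measurable μ) (hμ_pos : ∀ x, 0 < μ x) (hθ : Measurable θ)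
    (hθ_pos : ∀ x, 0 < θ x) (hagree : Agrees q μ θ) (hm : weightSup q μ θ < ∞) (hp : 1 ≤ p) :
    IsAdmissible q μ θ p := by
  obtain ⟨A, hA, hbound⟩ := h.exists_weightedNorm_greenOp_le hq hμ hμ_pos hθ hθ_pos hagree hm hp
  have hsol : ∀ f, MemWeightedLp θ p f →
      IsSolution q f (greenOp u v f) ∧ MemWeightedLp μ p (greenOp u v f) := fun f hf => by
    obtain ⟨hle, hi⟩ := hbound f hf.1.1
    have hz := h.isSolution_greenOp (hf.1.locallyIntegrable hp) (hi hf.2)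
    exact ⟨hz, .of_continuous hz.continuous p, hle.trans_lt (ENNReal.mul_lt_top hA hf.2)⟩
  have huniq : ∀ f y, MemWeightedLp θ p f → IsSolution q f y → MemWeightedLp μ p y →
      y = greenOp u v f := fun f y hf hy hyμ =>
    h.solution_unique hq hp hμ hμ_pos (hagree.subexponential_left hq hμ_pos) hy (hsol f hf).1
      hyμ.2 (hsol f hf).2.2
  refine ⟨fun f hf => ⟨_, hsol f hf, fun y hy => huniq f y hf hy.1 hy.2⟩, A.toReal + 1,
    by positivity, fun f y hf hy hyμ => ?_⟩
  rw [huniq f y hf hy hyμ]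
  refine (hbound f hf.1.1).1.trans ?_
  gcongr
  exact (ENNReal.le_ofReal_iff_toReal_le hA.ne (by positivity)).2 (by linarith)

/-! ### Necessity -/

section CompactSupport

variable {q μ u v f y : ℝ → ℝ} {p : ℝ≥0∞}

theorem greenOp_eq_mul_u {x : ℝ} (hf : ∀ t, x < t → f t = 0) :
    greenOp u v f x = (∫ t, v t * f t) * u x := by
  rw [greenOp, ← integral_mul_const]
  congr with t
  rcases lt_or_ge x t with hxt | htx
  · simp only [hf t hxt, mul_zero, zero_mul]
  · rw [green_of_ge htx]
    ring

theorem greenOp_eq_mul_v {x : ℝ} (hf : ∀ t, t < x → f t = 0) :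
    greenOp u v f x = (∫ t, u t * f t) * v x := by
  rw [greenOp, ← integral_mul_const]
  congr with t
  rcases lt_or_ge t x with htx | hxt
  · simp only [hf t htx, mul_zero, zero_mul]
  · rw [green_of_le hxt]
    ring

theorem PrincipalPair.integrable_green_mul_of_hasCompactSupport (h : PrincipalPair q u v)
    (hf : LocallyIntegrable f volume) (hfc : HasCompactSupport f) (x : ℝ) :
    Integrable fun t => green u v x t * f t := by
  have hloc : LocallyIntegrable (fun t => green u v x t * f t) volume :=
    hf.continuous_smul (h.continuous_green.comp (Continuous.prodMk_right x))
  refine (integrableOn_iff_integrable_of_support_subset ?_).1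
    (hloc.integrableOn_isCompact hfc.isCompact)
  exact (Function.support_mul_subset_right _ _).trans (subset_tsupport f)

theorem PrincipalPair.eq_greenOp_of_hasCompactSupport (h : PrincipalPair q u v)
    (hq : IsPotential q) (hp : p ≠ 0) (hμ : Measurable μ) (hμ_pos : ∀ x, 0 < μ x)
    (hμ_sub : Subexponential q fun x => √(averagingRadius q x) * μ x)
    (hf : LocallyIntegrable f volume) (hfc : HasCompactSupport f) (hy : IsSolution q f y)
    (hfin : weightedNorm μ p y < ∞) : y = greenOp u v f := by
  have hz := h.isSolution_greenOp hf (h.integrable_green_mul_of_hasCompactSupport hf hfc)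
  obtain ⟨b, hb⟩ := hfc.isCompact.bddAbove
  obtain ⟨a, ha⟩ := hfc.isCompact.bddBelow
  refine h.eq_of_weightedNorm_lt_top hq hp hμ hμ_pos hμ_sub hy hz hfin
    ((eventually_ge_atTop b).mono fun x hx => greenOp_eq_mul_u fun t ht => ?_)
    ((eventually_le_atBot a).mono fun x hx => greenOp_eq_mul_v fun t ht => ?_)
  · exact image_eq_zero_of_notMem_tsupport fun hmem => (hb hmem).not_gt (hx.trans_lt ht)
  · exact image_eq_zero_of_notMem_tsupport fun hmem => (ha hmem).not_gt (ht.trans_le hx)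

end CompactSupport

section Necessity

variable {q μ θ w f u v : ℝ → ℝ} {p : ℝ≥0∞}

theorem weightedNorm_indicator_one_le {s : Set ℝ} {M : ℝ} (hM : ∀ x ∈ s, |w x| ≤ M) :
    weightedNorm w p (s.indicator 1) ≤ ‖M‖ₑ * volume s ^ (1 / p.toReal) := by
  refine le_trans (eLpNorm_mono_real fun x => ?_) (eLpNorm_indicator_const_le M p)
  by_cases hx : x ∈ s
  · simpa [hx] using hM x hx
  · simp [hx]

theorem le_weightedNorm {s : Set ℝ} {m : ℝ} (hp : p ≠ 0) (hs : MeasurableSet s)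
    (hs0 : volume s ≠ 0) (hm : 0 ≤ m) (hwf : ∀ x ∈ s, m ≤ w x * f x) :
    ‖m‖ₑ * volume s ^ (1 / p.toReal) ≤ weightedNorm w p f := by
  rw [← eLpNorm_indicator_const' hs hs0 hp]
  refine eLpNorm_mono fun x => ?_
  by_cases hx : x ∈ s
  · rw [indicator_of_mem hx, Real.norm_of_nonneg hm]
    exact (hwf x hx).trans (le_abs_self _)
  · rw [indicator_of_notMem hx, norm_zero]
    exact norm_nonneg _

theorem memWeightedLp_indicator_one {a b M : ℝ} (hM : ∀ x ∈ Icc a b, |w x| ≤ M) :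
    MemWeightedLp w p ((Icc a b).indicator 1) := by
  have hLp : MemLp ((Icc a b).indicator 1 : ℝ → ℝ) p volume :=
    memLp_indicator_const p measurableSet_Icc 1 (Or.inr isCompact_Icc.measure_ne_top)
  exact ⟨⟨hLp.1, fun K _ => hLp.restrict K⟩, (weightedNorm_indicator_one_le hM).trans_lt
    (ENNReal.mul_lt_top enorm_lt_top
      (ENNReal.rpow_lt_top_of_nonneg (by positivity) isCompact_Icc.measure_ne_top))⟩

/-- The interval of length `d(x) / 96` about `x`, whose indicator serves as right-hand side. On its
square the Green function is at least `d(x) / 96`, since the diagonal value at `ξ` is at least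
`d(ξ) / 24 ≥ d(x) / 48` and the loss away from the diagonal is at most the distance to it. -/
def testInterval (q : ℝ → ℝ) (x : ℝ) : Set ℝ :=
  Icc (x - averagingRadius q x / 192) (x + averagingRadius q x / 192)

theorem mem_testInterval {x ξ : ℝ} :
    ξ ∈ testInterval q x ↔ |ξ - x| ≤ averagingRadius q x / 192 :=
  mem_Icc_iff_abs_le.symm.trans (by rw [abs_sub_comm])

theorem IsPotential.abs_sub_le_of_mem_testInterval (hq : IsPotential q) {x ξ : ℝ}
    (hξ : ξ ∈ testInterval q x) : |ξ - x| ≤ averagingRadius q x / 2 := by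
  linarith [mem_testInterval.1 hξ, hq.averagingRadius_pos x]

theorem measurableSet_testInterval (x : ℝ) : MeasurableSet (testInterval q x) :=
  measurableSet_Icc

theorem volume_testInterval (x : ℝ) :
    volume (testInterval q x) = ENNReal.ofReal (averagingRadius q x / 96) := by
  rw [testInterval, Real.volume_Icc]
  ring_nf

theorem PrincipalPair.le_green_of_mem_testInterval (h : PrincipalPair q u v) (hq : IsPotential q)
    {x ξ t : ℝ} (hξ : ξ ∈ testInterval q x) (ht : t ∈ testInterval q x) :
    averagingRadius q x / 96 ≤ green u v ξ t := by
  have hdist : |t - ξ| ≤ averagingRadius q x / 96 := by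
    have := abs_sub_le t x ξ
    rw [abs_sub_comm x ξ] at this
    linarith [mem_testInterval.1 hξ, mem_testInterval.1 ht]
  linarith [h.diag_sub_abs_le_green hq.nonneg ξ t, h.le_diag hq ξ,
    hq.half_le_averagingRadius (hq.abs_sub_le_of_mem_testInterval hξ)]

theorem PrincipalPair.le_greenOp_indicator_testInterval (h : PrincipalPair q u v)
    (hq : IsPotential q) {x ξ : ℝ} (hξ : ξ ∈ testInterval q x) :
    (averagingRadius q x / 96) ^ 2 ≤ greenOp u v ((testInterval q x).indicator 1) ξ := by
  have hd := hq.averagingRadius_pos x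
  have hgreenOp : greenOp u v ((testInterval q x).indicator 1) ξ =
      ∫ t in testInterval q x, green u v ξ t := by
    rw [greenOp, ← integral_indicator (measurableSet_testInterval x)]
    congr with t
    by_cases ht : t ∈ testInterval q x <;> simp [ht]
  have hvol : volume.real (testInterval q x) = averagingRadius q x / 96 := by
    rw [measureReal_def, volume_testInterval, ENNReal.toReal_ofReal (by positivity)]
  calc (averagingRadius q x / 96) ^ 2
      = ∫ _ in testInterval q x, averagingRadius q x / 96 := by
        rw [setIntegral_const, hvol, smul_eq_mul, sq]
    _ ≤ ∫ t in testInterval q x, green u v ξ t :=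
        setIntegral_mono_on (integrableOn_const isCompact_Icc.measure_ne_top)
          (h.continuous_green.comp (Continuous.prodMk_right ξ)).continuousOn.integrableOn_Icc
          (measurableSet_testInterval x) fun t ht => h.le_green_of_mem_testInterval hq hξ ht
    _ = _ := hgreenOp.symm

theorem PrincipalPair.exists_weightedNorm_greenOp_le_of_isAdmissible (h : PrincipalPair q u v)
    (hq : IsPotential q) (hμ : Measurable μ) (hμ_pos : ∀ x, 0 < μ x)
    (hμ_sub : Subexponential q fun x => √(averagingRadius q x) * μ x) (hp : 1 ≤ p)
    (hadm : IsAdmissible q μ θ p) :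
    ∃ c : ℝ, 0 < c ∧ ∀ f, MemWeightedLp θ p f → HasCompactSupport f →
      weightedNorm μ p (greenOp u v f) ≤ ENNReal.ofReal c * weightedNorm θ p f := by
  obtain ⟨hex, c, hc, hbound⟩ := hadm
  refine ⟨c, hc, fun f hf hfc => ?_⟩
  obtain ⟨y, ⟨hy, hyμ⟩, -⟩ := hex f hf
  rw [← h.eq_greenOp_of_hasCompactSupport hq (one_pos.trans_le hp).ne' hμ hμ_pos hμ_sub
    (hf.1.locallyIntegrable hp) hfc hy hyμ.2]
  exact hbound f y hf hy hyμ

theorem PrincipalPair.mul_sq_le_of_weightedNorm_greenOp_le (h : PrincipalPair q u v)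
    (hq : IsPotential q) (hp : p ≠ 0) {c m M x : ℝ} (hc : 0 ≤ c) (hm : 0 ≤ m)
    (hμm : ∀ ξ ∈ testInterval q x, m ≤ μ ξ) (hθM : ∀ ξ ∈ testInterval q x, |θ ξ| ≤ M)
    (hbound : weightedNorm μ p (greenOp u v ((testInterval q x).indicator 1)) ≤
      ENNReal.ofReal c * weightedNorm θ p ((testInterval q x).indicator 1)) :
    m * (averagingRadius q x / 96) ^ 2 ≤ c * M := by
  have hd := hq.averagingRadius_pos x
  have hx : x ∈ testInterval q x := mem_testInterval.2 (by rw [sub_self, abs_zero]; positivity)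
  have hM : 0 ≤ M := (abs_nonneg _).trans (hθM x hx)
  have hvol : volume (testInterval q x) ≠ 0 := by
    rw [volume_testInterval]
    exact (ENNReal.ofReal_pos.2 (by positivity)).ne'
  have hvol_top : volume (testInterval q x) ≠ ∞ := isCompact_Icc.measure_ne_top
  have hnorms : ‖m * (averagingRadius q x / 96) ^ 2‖ₑ * volume (testInterval q x) ^ (1 / p.toReal) ≤
      ENNReal.ofReal c * ‖M‖ₑ * volume (testInterval q x) ^ (1 / p.toReal) :=
    calc _ ≤ weightedNorm μ p (greenOp u v ((testInterval q x).indicator 1)) :=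
          le_weightedNorm hp (measurableSet_testInterval x) hvol (by positivity) fun ξ hξ =>
            mul_le_mul (hμm ξ hξ) (h.le_greenOp_indicator_testInterval hq hξ) (by positivity)
              (hm.trans (hμm ξ hξ))
      _ ≤ ENNReal.ofReal c * weightedNorm θ p ((testInterval q x).indicator 1) := hbound
      _ ≤ _ := by
          rw [mul_assoc]
          gcongr
          exact weightedNorm_indicator_one_le hθM
  rw [ENNReal.mul_le_mul_iff_left
    (ENNReal.rpow_pos (pos_iff_ne_zero.2 hvol) hvol_top).ne'
    (ENNReal.rpow_ne_top_of_nonneg (by positivity) hvol_top), Real.enorm_of_nonneg (by positivity),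
    Real.enorm_of_nonneg hM, ← ENNReal.ofReal_mul hc] at hnorms
  exact (ENNReal.ofReal_le_ofReal_iff (by positivity)).1 hnorms

theorem PrincipalPair.weightSup_lt_top (h : PrincipalPair q u v) (hq : IsPotential q)
    (hμ : Measurable μ) (hμ_pos : ∀ x, 0 < μ x) (hθ_pos : ∀ x, 0 < θ x) (hagree : Agrees q μ θ)
    (hp : 1 ≤ p) (hadm : IsAdmissible q μ θ p) : weightSup q μ θ < ∞ := by
  have hμ_sub := hagree.subexponential_left hq hμ_pos
  obtain ⟨A, hA, hμA⟩ := hμ_sub.exists_le_mul (fun x => (hμ_pos x).le) hq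
  obtain ⟨B, hB, hθB⟩ := Subexponential.exists_le_mul (w := fun x => (θ x)⁻¹)
    (hagree.subexponential_right hq hθ_pos) (fun x => (inv_pos.2 (hθ_pos x)).le) hq
  obtain ⟨c, hc, hbound⟩ :=
    h.exists_weightedNorm_greenOp_le_of_isAdmissible hq hμ hμ_pos hμ_sub hp hadm
  refine (iSup_le fun x => ENNReal.ofReal_le_ofReal ?_).trans_lt
    (ENNReal.ofReal_lt_top (r := 96 ^ 2 * (c * (A * B))))
  have hθx := hθ_pos x
  have hμ_ge : ∀ ξ ∈ testInterval q x, μ x / A ≤ μ ξ := fun ξ hξ =>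
    (div_le_iff₀' hA).2 (hμA x ξ (hq.abs_sub_le_of_mem_testInterval hξ))
  have hθ_le : ∀ ξ ∈ testInterval q x, |θ ξ| ≤ B * θ x := fun ξ hξ => by
    have := hθB x ξ (hq.abs_sub_le_of_mem_testInterval hξ)
    rw [abs_of_pos (hθ_pos ξ)]
    rwa [← div_eq_mul_inv, inv_eq_one_div, div_le_div_iff₀ hθx (hθ_pos ξ), one_mul] at this
  have htest := h.mul_sq_le_of_weightedNorm_greenOp_le hq (one_pos.trans_le hp).ne' hc.le
    (div_pos (hμ_pos x) hA).le hμ_ge hθ_le (hbound _ (memWeightedLp_indicator_one hθ_le)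
      (.intro isCompact_Icc fun ξ hξ => indicator_of_notMem hξ _))
  calc μ x / θ x * averagingRadius q x ^ 2
      = 96 ^ 2 * (A / θ x) * (μ x / A * (averagingRadius q x / 96) ^ 2) := by field_simp
    _ ≤ 96 ^ 2 * (A / θ x) * (c * (B * θ x)) := by gcongr
    _ = 96 ^ 2 * (c * (A * B)) := by field_simp

end Necessity

end SturmLiouville

theorem theorem4p7_general (q μ θ : ℝ → ℝ)
    (hq_loc : MeasureTheory.LocallyIntegrable q MeasureTheory.volume)
    (hq_nonneg : ∀ᵐ x : ℝ, 0 ≤ q x)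
    (hq_tails : SturmLiouville.PositiveTails q)
    (hμ : Measurable μ) (hμ_pos : ∀ x : ℝ, 0 < μ x)
    (hθ : Measurable θ) (hθ_pos : ∀ x : ℝ, 0 < θ x)
    (hagree : SturmLiouville.Agrees q μ θ) (p : ℝ≥0∞) (hp : 1 ≤ p) :
    SturmLiouville.IsAdmissible q μ θ p ↔ SturmLiouville.weightSup q μ θ < ∞ := by
  have hq : SturmLiouville.IsPotential q := ⟨hq_loc, hq_nonneg, hq_tails⟩
  obtain ⟨u, v, h⟩ := hq.exists_principalPair
  exact ⟨h.weightSup_lt_top hq hμ hμ_pos hθ_pos hagree hp,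
    fun hm => h.isAdmissible hq hμ hμ_pos hθ hθ_pos hagree hm hp⟩

theorem theorem4p7 (q μ θ : ℝ → ℝ)
    (hq_loc : MeasureTheory.LocallyIntegrable q MeasureTheory.volume)
    (hq_nonneg : ∀ᵐ x : ℝ, 0 ≤ q x)
    (hq_tails : SturmLiouville.PositiveTails q)
    (hμ_cont : Continuous μ) (hμ_pos : ∀ x : ℝ, 0 < μ x)
    (hθ_cont : Continuous θ) (hθ_pos : ∀ x : ℝ, 0 < θ x)
    (hμ_div : SturmLiouville.DivergentTails μ)
    (hqH : SturmLiouville.ClassH q)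
    (hagree : SturmLiouville.Agrees q μ θ)
    (p : ℝ≥0∞) (hp_one : 1 ≤ p) (hp_top : p ≠ ∞) :
    SturmLiouville.IsAdmissible q μ θ p ↔ SturmLiouville.weightSup q μ θ < ∞ :=
  theorem4p7_general q μ θ hq_loc hq_nonneg hq_tails hμ_cont.measurable hμ_pos
    hθ_cont.measurable hθ_pos hagree p hp_one
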